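/- Let $X$ be a smooth manifold and $A\to X$ a real Lie algebroid (a smooth real vector bundle of finite rank with a Lie bracket on $\Gamma(A)$ and an anchor $a:A\to TX$ preserving brackets and satisfying the Leibniz rule). Let $\mathcal X=[X/A]$ be the formal quotient, i.e. the graded manifold $A[1]$ with the homological vector field $d_A$. Its tangent complex $T_{\mathcal X}$, pulled back to $X$, is $a:A\to TX$ in degrees $-1,0$. Let $\Omega^p(T_{\mathcal X})^d$ denote the $T_{\mathcal X}$-valued $p$-forms of internal degree $d$ (total degree $p+d$), with $\delta=[d_A,-]$. These spaces vanish for $d<-1$, and: * $Q\in\Omega^1(T_{\mathcal X})^{-1}$ is a bundle map $Q:TX\to A$, and $S\in\Omega^2(T_{\mathcal X})^{-1}$ an alternating bundle map $S:\Lambda^2TX\to A$; * $K\in\Omega^1(T_{\mathcal X})^0$ is a triple $(D,l,r)$ with bundle maps $l:A\to A$, $r:TX\to TX$ and an operator $D:\Gamma(TX)\times\Gamma(A)\to\Gamma(A)$, $C^\infty(X)$-linear in the first and $\mathbb R$-linear in the second argument, with $D_V(f\alpha)=fD_V\alpha+V(f)\,l\alpha-(rV)(f)\,\alpha$. A homotopy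 holomorphic structure on $\mathcal X$ is a pair $\mathcal I=\sum_{p\ge1}\mathcal I_p$, $\mathcal I_p\in\Omega^p(T_{\mathcal X})^{1-p}$, $\mathcal Q=\sum_{p\ge 1}\mathcal Q_p$, $\mathcal Q_p\in\Omega^p(T_{\mathcal X})^{-p}$, with $$[\mathcal I,\mathcal Q]_{NR}=0,\qquad \delta\mathcal I+\tfrac12[\mathcal I,\mathcal I]_{FN}=0,\qquad \delta\mathcal Q+[\mathcal I,\mathcal Q]_{FN}+\tfrac12[\mathcal I,\mathcal I]_{NR}=-1 .$$ For degree reasons $\mathcal I=\mathcal I_1+\mathcal I_2$ and $\mathcal Q=\mathcal Q_1$. Write $\mathcal I_1=(D,l,r)$, $\mathcal I_2=S$, $\mathcal Q_1=Q$ and $[V,W]_r=[rV,W]+[V,rW]-r[V,W]$. Explicitly, for all vector fields $V,W,Z$ and sections $\alpha,\beta$ of $A$, the equations are: 1. $lQ=Qr$; 2. ($\delta\mathcal I_1=0$) $a\,l=r\,a$; $[\beta,l\alpha]-l[\beta,\alpha]=D_{a\alpha}\beta$; $[a\beta,rV]-r[a\beta,V]=a(D_V\beta)$; $[\beta,D_V\alpha]-D_{[a\beta,V]}\alpha-D_V[\beta,\alpha]=[\alpha,D_V\beta]-D_{[a\alpha,V]}\beta$;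 3. ($\delta\mathcal I_2+\frac12[\mathcal I_1,\mathcal I_1]_{FN}=0$) $a(S(V,W))+[rV,rW]-r[V,W]_r=0$; $S(a\alpha,V)+D_V(l\alpha)-l\,D_V\alpha=0$; $[\alpha,S(V,W)]-S([a\alpha,V],W)-S(V,[a\alpha,W])+D_WD_V\alpha-D_VD_W\alpha-D_{[V,W]_r}\alpha+l\,D_{[V,W]}\alpha=0$; 4. ($[\mathcal I_1,\mathcal I_2]_{FN}=0$) the cyclic sum over $(V,W,Z)$ of $-D_V(S(W,Z))-S([V,W]_r,Z)+l\,S([V,W],Z)$ vanishes; 5. ($\delta\mathcal Q_1+\frac12[\mathcal I_1,\mathcal I_1]_{NR}=-1$) $aQ+r^2=-1$; $Qa+l^2=-1$; $[\alpha,QV]-Q[a\alpha,V]+D_{rV}\alpha+l\,D_V\alpha=0$; 6. ($[\mathcal I_1,\mathcal Q_1]_{FN}+[\mathcal I_1,\mathcal I_2]_{NR}=0$) $D_V(QW)-D_W(QV)+Q[V,W]_r-l\,Q[V,W]+S(rV,W)+S(V,rW)+2\,l\,S(V,W)=0$. A complex Lie algebroid $\mathcal L$ over $\mathcal X$ is given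 by a complex Lie algebroid $B\to X$ with anchor $\rho_B:B\to TX\otimes\mathbb C$ and a morphism of Lie algebroids $\varphi:A\otimes\mathbb C\to B$ over $X$ (equivalently, by the formal quotient map $[X/A\otimes\mathbb C]\to[X/B]$). Its underlying complex on $X$ is $\varphi:A\otimes\mathbb C\to B$ in degrees $-1,0$, and its anchor $\rho:\mathcal L\to T_{\mathcal X}^{\mathbb C}$ is $(\mathrm{id},\rho_B)$. It is an anti-holomorphic foliation if $\rho\oplus\bar\rho:\mathcal L\oplus\bar{\mathcal L}\to T^{\mathbb C}_{\mathcal X}$ is a quasi-isomorphism. **Theorem.** Let $(\mathcal X,\mathcal I,\mathcal Q)$ be a homotopy holomorphic stack, $\mathcal X=[X/A]$ as above. Then $\mathcal X$ admits a canonical anti-holomorphic foliation $\mathcal L$ together with a homotopy $\gamma:\mathcal L\to T^{\mathbb C}_{\mathcal X}[-1]$ from $\mathcal I_1\circ\rho$ to $\rho\circ(-i)$: a complex linear bundle map $\gamma:B\to A\otimes\mathbb C$ such that $a\gamma=r\rho_B+i\rho_B$ on $B$, $\gamma\varphi=l+i$ on $A\otimes\mathbb C$, and $D_{\rho_B(v)}\alpha=\gamma[v,\varphi\alpha]-[\gamma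 v,\alpha]$ for all sections $v$ of $B$ and $\alpha$ of $A$ (the operations of $A$ being extended complex linearly). Canonical means functorial: $(\mathcal L,\gamma)$ can be assigned to all homotopy holomorphic stacks of a given base dimension so that every isomorphism $(X,A,\mathcal I,\mathcal Q)\cong(X',A',\mathcal I',\mathcal Q')$ lifts to an isomorphism of the foliations with their homotopies, compatibly with identities and composition. -/

import Mathlib

open scoped Manifold ContDiff Bundle

universe u

noncomputable section

namespace HomotopyHolomorphic

/-! ### Manifolds, smooth functions, sections, vector fields -/

/-- A smooth `n`-dimensional manifold (Hausdorff, second countable, without boundary). -/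
structure SmoothManifold (n : ℕ) where
  carrier : Type u
  [top : TopologicalSpace carrier]
  [charted : ChartedSpace (EuclideanSpace ℝ (Fin n)) carrier]
  [smooth : IsManifold (𝓡 n) ∞ carrier]
  [hausdorff : T2Space carrier]
  [secondCountable : SecondCountableTopology carrier]

attribute [instance] SmoothManifold.top SmoothManifold.charted SmoothManifold.smooth
  SmoothManifold.hausdorff SmoothManifold.secondCountable

instance (n : ℕ) : CoeSort (SmoothManifold.{u} n) (Type u) := ⟨SmoothManifold.carrier⟩

/-- The ring `C^∞(X)` of real smooth functions. -/
abbrev SmoothFun {n : ℕ} (X : SmoothManifold.{u} n) : Type u := C^∞⟮𝓡 n, X; 𝓘(ℝ, ℝ), ℝ⟯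

section Sections

variable {n : ℕ} {X : SmoothManifold.{u} n} {F : Type*} [NormedAddCommGroup F] [NormedSpace ℝ F]
  {V : X → Type*} [TopologicalSpace (Bundle.TotalSpace F V)] [∀ x, TopologicalSpace (V x)]
  [FiberBundle F V] [∀ x, AddCommGroup (V x)] [∀ x, Module ℝ (V x)] [VectorBundle ℝ F V]

/-- Pointwise multiplication of sections by smooth functions. -/
instance sectionModule : Module (SmoothFun X) Cₛ^∞⟮𝓡 n; F, V⟯ where
  smul f s := ⟨fun x => f x • s x, f.contMDiff.smul_section s.contMDiff⟩
  one_smul s := by ext x; exact one_smul ℝ (s x)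
  mul_smul f g s := by ext x; exact mul_smul (f x) (g x) (s x)
  smul_zero f := by ext x; exact smul_zero (f x)
  smul_add f s t := by ext x; exact smul_add (f x) (s x) (t x)
  add_smul f g s := by ext x; exact add_smul (f x) (g x) (s x)
  zero_smul s := by ext x; exact zero_smul ℝ (s x)

instance sectionSMulComm : SMulCommClass ℝ (SmoothFun X) Cₛ^∞⟮𝓡 n; F, V⟯ where
  smul_comm c f s := by ext x; exact smul_comm c (f x) (s x)

end Sections

/-- Smooth vector fields on `X`. -/
abbrev VField {n : ℕ} (X : SmoothManifold.{u} n) : Type u :=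
  Cₛ^∞⟮𝓡 n; EuclideanSpace ℝ (Fin n), (TangentSpace (𝓡 n) : X → Type)⟯

section VectorFields

variable {n : ℕ} {X Y : SmoothManifold.{u} n}

/-- The derivative `V f` of a smooth function along a vector field. -/
def VField.deriv (V : VField X) (f : SmoothFun X) : SmoothFun X :=
  ⟨fun x => mvfderiv (𝓡 n) f x (V x), by
    have h := (ContMDiff.contMDiff_tangentMap (m := ∞) f.contMDiff (by simp)).comp V.contMDiff
    exact (contMDiff_snd_tangentBundle_modelSpace ℝ 𝓘(ℝ, ℝ)).comp h⟩

/-- The Lie bracket of vector fields. -/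
def VField.bracket (V W : VField X) : VField X :=
  ⟨VectorField.mlieBracket (𝓡 n) V W, by
    have : IsManifold (𝓡 n) ((⊤ : ℕ∞) + 1) X := X.smooth
    have : IsManifold (𝓡 n) (minSmoothness ℝ 2) X := by
      rw [minSmoothness_of_isRCLikeNormedField]; infer_instance
    exact ContDiff.mlieBracket_vectorField (m := ⊤) (n := ⊤) V.contMDiff W.contMDiff (by simp)⟩

/-- The push-forward of a vector field along a diffeomorphism. -/
def VField.push (f : X ≃ₘ⟮𝓡 n, 𝓡 n⟯ Y) (V : VField X) : VField Y :=
  ⟨VectorField.mpullback (𝓡 n) (𝓡 n) f.symm V,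
    V.contMDiff.mpullback_vectorField f.symm.contMDiff
      (fun y => ⟨f.symm.mfderivToContinuousLinearEquiv (by simp) y, rfl⟩) (by simp)⟩

/-- The push-forward `s ∘ f⁻¹` of a function along a diffeomorphism. -/
def SmoothFun.push (f : X ≃ₘ⟮𝓡 n, 𝓡 n⟯ Y) (s : SmoothFun X) : SmoothFun Y :=
  ⟨fun y => s (f.symm y), s.contMDiff.comp f.symm.contMDiff⟩

end VectorFields

/-! ### Vector bundles and Lie algebroids

Vector bundle morphisms are written as `C^∞(X)`-linear maps between the modules of sections. -/

/-- A smooth real vector bundle of finite rank. -/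
structure SmoothVectorBundle {n : ℕ} (X : SmoothManifold.{u} n) where
  F : Type u
  [normedAddCommGroup : NormedAddCommGroup F]
  [normedSpace : NormedSpace ℝ F]
  [finiteDimensional : FiniteDimensional ℝ F]
  fiber : X → Type u
  [topTotal : TopologicalSpace (Bundle.TotalSpace F fiber)]
  [topFiber : ∀ x, TopologicalSpace (fiber x)]
  [fiberBundle : FiberBundle F fiber]
  [addCommGroup : ∀ x, AddCommGroup (fiber x)]
  [module : ∀ x, Module ℝ (fiber x)]
  [vectorBundle : VectorBundle ℝ F fiber]
  [smooth : ContMDiffVectorBundle ∞ F fiber (𝓡 n)]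

attribute [instance] SmoothVectorBundle.normedAddCommGroup SmoothVectorBundle.normedSpace
  SmoothVectorBundle.finiteDimensional SmoothVectorBundle.topTotal SmoothVectorBundle.topFiber
  SmoothVectorBundle.fiberBundle SmoothVectorBundle.addCommGroup SmoothVectorBundle.module
  SmoothVectorBundle.vectorBundle SmoothVectorBundle.smooth

/-- The module of smooth sections. -/
abbrev SmoothVectorBundle.Sec {n : ℕ} {X : SmoothManifold.{u} n} (E : SmoothVectorBundle X) :
    Type u :=
  Cₛ^∞⟮𝓡 n; E.F, E.fiber⟯

/-- A real Lie algebroid over `X`. -/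
structure LieAlgebroid {n : ℕ} (X : SmoothManifold.{u} n) extends SmoothVectorBundle X where
  bracket : toSmoothVectorBundle.Sec →ₗ[ℝ] toSmoothVectorBundle.Sec →ₗ[ℝ] toSmoothVectorBundle.Sec
  anchor : toSmoothVectorBundle.Sec →ₗ[SmoothFun X] VField X
  bracket_self : ∀ α, bracket α α = 0
  jacobi : ∀ α β γ,
    bracket α (bracket β γ) = bracket (bracket α β) γ + bracket β (bracket α γ)
  leibniz : ∀ α (f : SmoothFun X) β,
    bracket α (f • β) = f • bracket α β + (anchor α).deriv f • β
  anchor_bracket : ∀ α β, anchor (bracket α β) = (anchor α).bracket (anchor β)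

/-! ### Tangent-valued forms on the formal quotient `𝒳 = [X/A]`

`𝒳` is the graded manifold `A[1]` with the homological vector field `d_A`.  Vector fields on `A[1]`
are generated over the functions by those of weight `-1`, which are the vertical lifts `α↑` of
sections `α` of `A`, and those of weight `0`, which are the derivations `V` of the module `Γ(A)`
covering a vector field `X` (the symbol of `V`); here `[V, α↑] = (V α)↑`, the field `[d_A, α↑]` is
the derivation `[α, -]` with symbol the anchor of `α`.  There are no vector fields of weight less
than `-1` and no forms of negative weight, so `Ω^p(T_𝒳)^d = 0` for `d < -1`.  Hence the components
of `𝓘 ∈ ∏_{p ≥ 1} Ω^p(T_𝒳)^{1-p}` are `𝓘₁, 𝓘₂` only, and the only component of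
`𝓠 ∈ ∏_{p ≥ 1} Ω^p(T_𝒳)^{-p}` is `𝓠₁`. -/

section Forms

variable {n : ℕ} {X : SmoothManifold.{u} n} (A : LieAlgebroid X)

/-- An element `K` of `Ω¹(T_𝒳)⁰` as a differential operator `D` with its symbols `l : A → A` and
`r : TX → TX`.  As an endomorphism of vector fields on `A[1]` it sends `α↑` to `(l α)↑` and a
derivation `V` with symbol `X` to the derivation `α ↦ l (V α) - D X α` with symbol `r X`; so
`D X α` is `(L_{α↑} K)(X)`. -/
structure EndForm where
  D : VField X →ₗ[SmoothFun X] A.Sec →ₗ[ℝ] A.Sec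
  l : A.Sec →ₗ[SmoothFun X] A.Sec
  r : VField X →ₗ[SmoothFun X] VField X
  D_leibniz : ∀ V (f : SmoothFun X) α,
    D V (f • α) = f • D V α + V.deriv f • l α - (r V).deriv f • α

/-- `Ω¹(T_𝒳)⁻¹`: bundle maps `TX → A`. -/
abbrev CoreForm1 : Type u := VField X →ₗ[SmoothFun X] A.Sec

/-- `Ω²(T_𝒳)⁻¹`: alternating bundle maps `TX × TX → A`. -/
structure CoreForm2 where
  toLin : VField X →ₗ[SmoothFun X] VField X →ₗ[SmoothFun X] A.Sec
  alt : ∀ V, toLin V V = 0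

/-- Components `(D, l, r)` of an element of `Ω¹(T_𝒳)⁰`, as in `EndForm`. -/
abbrev Comp10 : Type u :=
  (VField X → A.Sec → A.Sec) × (A.Sec → A.Sec) × (VField X → VField X)

/-- Components of an element `U` of `Ω¹(T_𝒳)¹`: for each section `β` the components of `L_{β↑} U`,
and the symbol of the derivation `U(α↑)`. -/
abbrev Comp11 : Type u := (A.Sec → Comp10 A) × (A.Sec → VField X)

/-- Components of an element `U` of `Ω²(T_𝒳)⁰`: `(L_{α↑} U)(V, W)`, `U(α↑, V)`, and the symbol of
`U(V, W)`. -/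
abbrev Comp20 : Type u :=
  (A.Sec → VField X → VField X → A.Sec) × (A.Sec → VField X → A.Sec) ×
    (VField X → VField X → VField X)

variable {A}

/-! #### The internal differential `δ = [d_A, -]` -/

/-- `δ : Ω¹(T_𝒳)⁻¹ → Ω¹(T_𝒳)⁰`. -/
def deltaCore1 (Q : CoreForm1 A) : Comp10 A :=
  (fun V α => A.bracket α (Q V) - Q ((A.anchor α).bracket V),
   fun α => Q (A.anchor α),
   fun V => A.anchor (Q V))

/-- The Lie derivative of `K ∈ Ω¹(T_𝒳)⁰` along the derivation `[β, -]` of `Γ(A)`. -/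
def EndForm.lieDeriv (K : EndForm A) (β : A.Sec) : Comp10 A :=
  (fun V α => A.bracket β (K.D V α) - K.D ((A.anchor β).bracket V) α - K.D V (A.bracket β α),
   fun α => A.bracket β (K.l α) - K.l (A.bracket β α),
   fun V => (A.anchor β).bracket (K.r V) - K.r ((A.anchor β).bracket V))

/-- The bundle map `D(β) = L_{β↑} K : TX → A`, `V ↦ D V β`. -/
def EndForm.DAt (K : EndForm A) (β : A.Sec) : CoreForm1 A where
  toFun V := K.D V β
  map_add' V W := by simp
  map_smul' f V := by simp

/-- `δ : Ω¹(T_𝒳)⁰ → Ω¹(T_𝒳)¹`: up to sign `L_{β↑}(δK) = L_{[β, -]} K - δ(L_{β↑} K)`, and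
`(δK)(α↑)` is the derivation `[l α, -] - K([α, -])`. -/
def EndForm.delta (K : EndForm A) : Comp11 A :=
  (fun β => K.lieDeriv β - deltaCore1 (K.DAt β),
   fun α => A.anchor (K.l α) - K.r (A.anchor α))

/-- `δ : Ω²(T_𝒳)⁻¹ → Ω²(T_𝒳)⁰`. -/
def CoreForm2.delta (S : CoreForm2 A) : Comp20 A :=
  (fun α V W => A.bracket α (S.toLin V W) - S.toLin ((A.anchor α).bracket V) W
      - S.toLin V ((A.anchor α).bracket W),
   fun α V => S.toLin (A.anchor α) V,
   fun V W => A.anchor (S.toLin V W))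

/-! #### Frölicher–Nijenhuis brackets -/

/-- The bracket `[V, W]_r = [rV, W] + [V, rW] - r[V, W]`. -/
def EndForm.rBracket (K : EndForm A) (V W : VField X) : VField X :=
  (K.r V).bracket W + V.bracket (K.r W) - K.r (V.bracket W)

/-- `½[K, K]_FN ∈ Ω²(T_𝒳)⁰`, that is, the Nijenhuis torsion
`[KV, KW] - K[KV, W] - K[V, KW] + K²[V, W]` on vector fields of `A[1]`. -/
def EndForm.halfFN (K : EndForm A) : Comp20 A :=
  (fun α V W => K.D W (K.D V α) - K.D V (K.D W α) - K.D (K.rBracket V W) α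
      + K.l (K.D (V.bracket W) α),
   fun α V => K.D V (K.l α) - K.l (K.D V α),
   fun V W => (K.r V).bracket (K.r W) - K.r (K.rBracket V W))

/-- `[K, Q]_FN ∈ Ω²(T_𝒳)⁻¹` for `K ∈ Ω¹(T_𝒳)⁰`, `Q ∈ Ω¹(T_𝒳)⁻¹`.  The overall sign is the one
of the total grading (`K` has degree `1`, `Q` has degree `0`), in which
`δ[K, Q] = [δK, Q] - [K, δQ]`. -/
def EndForm.fnCore1 (K : EndForm A) (Q : CoreForm1 A) : VField X → VField X → A.Sec :=
  fun V W => K.D V (Q W) - K.D W (Q V) + Q (K.rBracket V W) - K.l (Q (V.bracket W))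

/-- `[K, S]_FN ∈ Ω³(T_𝒳)⁻¹` for `K ∈ Ω¹(T_𝒳)⁰`, `S ∈ Ω²(T_𝒳)⁻¹` (a cyclic sum). -/
def EndForm.fnCore2 (K : EndForm A) (S : CoreForm2 A) :
    VField X → VField X → VField X → A.Sec :=
  let t : VField X → VField X → VField X → A.Sec := fun V W Z =>
    - K.D V (S.toLin W Z) - S.toLin (K.rBracket V W) Z + K.l (S.toLin (V.bracket W) Z)
  fun V W Z => t V W Z + t W Z V + t Z V W

/-! #### Nijenhuis–Richardson brackets

The bracket is the graded commutator, for the total degree, of the insertion product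
`(K ∘ L)(V₁, …) = ∑_σ sgn(σ) K(L(V_{σ 1}, …, V_{σ q}), …)`, where `σ` runs over all permutations.
This is the normalisation for which the equations below are compatible with `δ_𝓘² = 0`: since
`[K, K²]_FN = N(K·, ·) + N(·, K·) + 2 K N` for the torsion `N` of `K`, the terms `S(K·, ·) + S(·, K·)`
and `K S` of `[K, S]_NR` occur in the ratio `1 : 2`. -/

/-- The identity of `T_𝒳`. -/
def idComp : Comp10 A := (fun _ _ => 0, fun α => α, fun V => V)

/-- `½[K, K]_NR = K ∘ K ∈ Ω¹(T_𝒳)⁰`. -/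
def EndForm.halfNR (K : EndForm A) : Comp10 A :=
  (fun V α => K.D (K.r V) α + K.l (K.D V α), fun α => K.l (K.l α), fun V => K.r (K.r V))

/-- `[K, Q]_NR = K ∘ Q - Q ∘ K ∈ Ω¹(T_𝒳)⁻¹`. -/
def EndForm.nrCore1 (K : EndForm A) (Q : CoreForm1 A) : VField X → A.Sec :=
  fun V => K.l (Q V) - Q (K.r V)

/-- `[K, S]_NR = K ∘ S + S ∘ K ∈ Ω²(T_𝒳)⁻¹`. -/
def EndForm.nrCore2 (K : EndForm A) (S : CoreForm2 A) : VField X → VField X → A.Sec :=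
  fun V W => (K.l (S.toLin V W) - K.l (S.toLin W V))
    + (S.toLin (K.r V) W - S.toLin (K.r W) V)

end Forms

/-! ### Homotopy holomorphic structures -/

/-- A homotopy holomorphic structure `(𝓘, 𝓠) = (𝓘₁ + 𝓘₂, 𝓠₁)` on `𝒳 = [X/A]`:
`[𝓘, 𝓠]_NR = 0`, `δ𝓘 + ½[𝓘, 𝓘]_FN = 0`, `δ_𝓘 𝓠 + ½[𝓘, 𝓘]_NR = -1` with `δ_𝓘 = δ + [𝓘, -]_FN`,
each equation sorted by form degree.  The remaining components of the equations lie in spaces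
`Ω^p(T_𝒳)^d` with `d < -1`, which are zero. -/
structure HomotopyHolomorphicStructure {n : ℕ} {X : SmoothManifold.{u} n}
    (A : LieAlgebroid X) where
  I₁ : EndForm A
  I₂ : CoreForm2 A
  Q₁ : CoreForm1 A
  commute : I₁.nrCore1 Q₁ = 0
  maurerCartan₁ : I₁.delta = 0
  maurerCartan₂ : I₂.delta + I₁.halfFN = 0
  maurerCartan₃ : I₁.fnCore2 I₂ = 0
  square₁ : deltaCore1 Q₁ + I₁.halfNR = -idComp
  square₂ : I₁.fnCore1 Q₁ + I₁.nrCore2 I₂ = 0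

/-- A homotopy holomorphic stack `([X/A], 𝓘, 𝓠)`. -/
structure HomotopyHolomorphicStack (n : ℕ) where
  X : SmoothManifold.{u} n
  A : LieAlgebroid X
  hol : HomotopyHolomorphicStructure A

/-! ### Complexification and two-term complexes -/

section Complexification

variable {R M : Type*} [CommRing R] [AddCommGroup M] [Module R M]

/-- Multiplication by `i` on `M ⊗ ℂ = M ⊕ iM`, written as pairs (real part, imaginary part). -/
def mulI : M × M →ₗ[R] M × M where
  toFun p := (-p.2, p.1)
  map_add' p q := by ext <;> simp [add_comm]
  map_smul' c p := by ext <;> simp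

/-- Complex conjugation on `M ⊗ ℂ`. -/
def conj : M × M →ₗ[R] M × M where
  toFun p := (p.1, -p.2)
  map_add' p q := by ext <;> simp [add_comm]
  map_smul' c p := by ext <;> simp

end Complexification

/-- A morphism `(f, g)` of two-term complexes `d : M → N`, `d' : M' → N'` (in degrees `-1`, `0`) is
a quasi-isomorphism: it commutes with the differentials and is bijective on kernels and on
cokernels. -/
structure IsQuasiIso {R M N M' N' : Type*} [CommRing R] [AddCommGroup M] [AddCommGroup N]
    [AddCommGroup M'] [AddCommGroup N'] [Module R M] [Module R N] [Module R M'] [Module R N']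
    (d : M →ₗ[R] N) (d' : M' →ₗ[R] N') (f : M →ₗ[R] M') (g : N →ₗ[R] N') : Prop where
  comm : g ∘ₗ d = d' ∘ₗ f
  ker_injective : ∀ m, d m = 0 → f m = 0 → m = 0
  ker_surjective : ∀ m', d' m' = 0 → ∃ m, d m = 0 ∧ f m = m'
  coker_injective : ∀ y, (∃ m', g y = d' m') → ∃ m, y = d m
  coker_surjective : ∀ y', ∃ y m', y' = g y + d' m'

/-! ### Complex Lie algebroids over `X` and over `[X/A]` -/

/-- A complex Lie algebroid over the smooth manifold `X`: a smooth complex vector bundle, given as a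
real bundle with a complex structure `j`, with a complex bilinear Lie bracket on sections and a
complex linear anchor to `TX ⊗ ℂ`.  For complex functions the Leibniz rule follows from the one for
real functions. -/
structure ComplexLieAlgebroid {n : ℕ} (X : SmoothManifold.{u} n) extends
    SmoothVectorBundle X where
  j : toSmoothVectorBundle.Sec →ₗ[SmoothFun X] toSmoothVectorBundle.Sec
  j_sq : ∀ v, j (j v) = -v
  bracket : toSmoothVectorBundle.Sec →ₗ[ℝ] toSmoothVectorBundle.Sec →ₗ[ℝ] toSmoothVectorBundle.Sec
  anchor : toSmoothVectorBundle.Sec →ₗ[SmoothFun X] VField X × VField X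
  bracket_self : ∀ v, bracket v v = 0
  jacobi : ∀ u v w,
    bracket u (bracket v w) = bracket (bracket u v) w + bracket v (bracket u w)
  bracket_j : ∀ v w, bracket v (j w) = j (bracket v w)
  anchor_j : ∀ v, anchor (j v) = mulI (R := SmoothFun X) (anchor v)
  leibniz : ∀ v (f : SmoothFun X) w, bracket v (f • w) =
    f • bracket v w + (anchor v).1.deriv f • w + (anchor v).2.deriv f • j w
  anchor_bracket : ∀ v w, anchor (bracket v w) =
    ((anchor v).1.bracket (anchor w).1 - (anchor v).2.bracket (anchor w).2,
     (anchor v).1.bracket (anchor w).2 + (anchor v).2.bracket (anchor w).1)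

/-- A complex Lie algebroid `𝓛` over the formal quotient `𝒳 = [X/A]`, presented on the atlas `X`: a
complex Lie algebroid `B` over `X` with a morphism `φ : A ⊗ ℂ → B` of Lie algebroids over `X`.  It is
the relative tangent complex of `[X/A ⊗ ℂ] → [X/B]`; as a dg Lie algebroid over `(A[1], d_A)` it is
the pull-back of `B` along `A[1] → X`, with differential the bracket with the section `(d_A, φ)`.
Its pull-back to `X` is the complex `φ : A ⊗ ℂ → B` in degrees `-1, 0`. -/
structure ComplexLieAlgebroidOver {n : ℕ} {X : SmoothManifold.{u} n} (A : LieAlgebroid X) extends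
    ComplexLieAlgebroid X where
  φ : A.Sec →ₗ[SmoothFun X] toSmoothVectorBundle.Sec
  anchor_φ : ∀ α, anchor (φ α) = (A.anchor α, 0)
  φ_bracket : ∀ α β, φ (A.bracket α β) = bracket (φ α) (φ β)

section Foliations

variable {n : ℕ} {X : SmoothManifold.{u} n} {A : LieAlgebroid X}

/-- The differential `A ⊗ ℂ → B` of the complex `𝓛`, the complex linear extension of `φ`. -/
def ComplexLieAlgebroidOver.d (L : ComplexLieAlgebroidOver A) :
    A.Sec × A.Sec →ₗ[SmoothFun X] L.Sec :=
  L.φ.coprod (L.j ∘ₗ L.φ)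

variable (A) in
/-- The differential `A ⊗ ℂ → TX ⊗ ℂ` of the complexified tangent complex `T_𝒳^ℂ`. -/
def tangentD : A.Sec × A.Sec →ₗ[SmoothFun X] VField X × VField X :=
  A.anchor.prodMap A.anchor

/-- `𝓛` is an anti-holomorphic foliation on `𝒳`: `ρ ⊕ ρ̄ : 𝓛 ⊕ 𝓛̄ → T_𝒳^ℂ` is a quasi-isomorphism.
The anchor `ρ : 𝓛 → T_𝒳^ℂ` is the identity of `A ⊗ ℂ` in degree `-1` and the anchor of `B` in degree
`0`; `𝓛̄` has the same underlying real complex as `𝓛`, and `ρ̄` is the conjugate of `ρ`. -/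
def ComplexLieAlgebroidOver.IsAntiHolomorphicFoliation (L : ComplexLieAlgebroidOver A) : Prop :=
  IsQuasiIso (L.d.prodMap L.d) (tangentD A)
    (LinearMap.coprod LinearMap.id (conj (R := SmoothFun X)))
    (L.anchor.coprod (conj ∘ₗ L.anchor))

/-- A homotopy `γ : 𝓛 → T_𝒳[-1]` from `𝓘₁ ∘ ρ` to `ρ ∘ (-i)`, that is, `[δ, γ] = 𝓘₁ ∘ ρ + i ρ`.
For degree reasons `γ` is a complex linear bundle map `B → A ⊗ ℂ`; the three conditions are the
identity on `B`, on `A ⊗ ℂ` (both over the atlas `X`), and its component along `A`, which makes `γ` a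
homotopy over `𝒳`. -/
structure AnchorHomotopy (I₁ : EndForm A) (L : ComplexLieAlgebroidOver A) where
  γ : L.Sec →ₗ[SmoothFun X] A.Sec × A.Sec
  γ_j : ∀ v, γ (L.j v) = mulI (R := SmoothFun X) (γ v)
  degree_zero : ∀ v, tangentD A (γ v) =
    I₁.r.prodMap I₁.r (L.anchor v) + mulI (R := SmoothFun X) (L.anchor v)
  degree_neg_one : ∀ p, γ (L.d p) = I₁.l.prodMap I₁.l p + mulI (R := SmoothFun X) p
  equivariant : ∀ v α,
    (I₁.D (L.anchor v).1 α, I₁.D (L.anchor v).2 α) =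
      γ (L.bracket v (L.φ α)) - (A.bracket (γ v).1 α, A.bracket (γ v).2 α)

end Foliations

/-- An anti-holomorphic foliation on a homotopy holomorphic stack with a homotopy making `𝓘₁` act on
it as `-i`. -/
structure HolomorphicFoliation {n : ℕ} (𝒳 : HomotopyHolomorphicStack.{u} n) where
  L : ComplexLieAlgebroidOver 𝒳.A
  isFoliation : L.IsAntiHolomorphicFoliation
  homotopy : AnchorHomotopy 𝒳.hol.I₁ L

/-! ### Isomorphisms -/

/-- An isomorphism of homotopy holomorphic stacks presented by Lie algebroids: a diffeomorphism of
the bases and a bundle isomorphism covering it, preserving all structures. -/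
structure StackIso {n : ℕ} (𝒳 𝒴 : HomotopyHolomorphicStack.{u} n) where
  base : 𝒳.X ≃ₘ⟮𝓡 n, 𝓡 n⟯ 𝒴.X
  onA : 𝒳.A.Sec ≃+ 𝒴.A.Sec
  map_smul : ∀ (f : SmoothFun 𝒳.X) α, onA (f • α) = SmoothFun.push base f • onA α
  map_bracket : ∀ α β, onA (𝒳.A.bracket α β) = 𝒴.A.bracket (onA α) (onA β)
  map_anchor : ∀ α, (𝒳.A.anchor α).push base = 𝒴.A.anchor (onA α)
  map_D : ∀ V α, onA (𝒳.hol.I₁.D V α) = 𝒴.hol.I₁.D (V.push base) (onA α)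
  map_l : ∀ α, onA (𝒳.hol.I₁.l α) = 𝒴.hol.I₁.l (onA α)
  map_r : ∀ V, (𝒳.hol.I₁.r V).push base = 𝒴.hol.I₁.r (V.push base)
  map_I₂ : ∀ V W, onA (𝒳.hol.I₂.toLin V W) = 𝒴.hol.I₂.toLin (V.push base) (W.push base)
  map_Q₁ : ∀ V, onA (𝒳.hol.Q₁ V) = 𝒴.hol.Q₁ (V.push base)

/-- An isomorphism of foliations with homotopies covering an isomorphism of stacks. -/
@[ext]
structure FoliationIso {n : ℕ} {𝒳 𝒴 : HomotopyHolomorphicStack.{u} n} (e : StackIso 𝒳 𝒴)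
    (P : HolomorphicFoliation 𝒳) (P' : HolomorphicFoliation 𝒴) where
  onB : P.L.Sec ≃+ P'.L.Sec
  map_smul : ∀ (f : SmoothFun 𝒳.X) v, onB (f • v) = SmoothFun.push e.base f • onB v
  map_j : ∀ v, onB (P.L.j v) = P'.L.j (onB v)
  map_bracket : ∀ v w, onB (P.L.bracket v w) = P'.L.bracket (onB v) (onB w)
  map_anchor : ∀ v, ((P.L.anchor v).1.push e.base, (P.L.anchor v).2.push e.base) =
    P'.L.anchor (onB v)
  map_φ : ∀ α, onB (P.L.φ α) = P'.L.φ (e.onA α)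
  map_γ : ∀ v, (e.onA (P.homotopy.γ v).1, e.onA (P.homotopy.γ v).2) = P'.homotopy.γ (onB v)

end HomotopyHolomorphic

end

/-! On `TX ⊕ A` put `J (V, β) = (rV + aβ, QV - lβ)`. The relations `aQ + r² = -1`, `Qa + l² = -1`,
`al = ra` and `lQ = Qr` together say that `J² = -1`. The bundle `B` is the `-i`-eigenbundle of `J`
in the complexification. After a change of sign in the second component its elements are the pairs
`(V, β)` with `aβ = (r + i)V` and `lβ = iβ - QV` (`IsEigen`). The anchor is `V` and the homotopy `γ`
is `β`, so the first eigenvalue equation is already the homotopy condition on `B`.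

The first component of the bracket of `(V, β)` and `(W, η)` must be `[V, W]`. Substituting `rV = aβ
- iV` and `rW = aη - iW` in the torsion equation gives `a([β, η] + D_V η - D_W β - S(V, W) + Q[V,
W]) = 2i(r + i)[V, W]`, which suggests `1/(2i)` times the expression in parentheses as second
component. That the result is again an eigenpair (`IsEigen.bracket`) and that the Jacobi identity
holds (`IsEigen.preBracket_cyclic`) both rest on `IsEigen.D_Q`: on eigenpairs the compatibility of
`Q` with `S` determines `D_V (QW)` itself and not only its skew part. The map `φ α = (aα, (l + i)α)`
lands in eigenpairs, and `IsEigen.bracket_φ` is the equivariance of `γ`.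

On `ker a` and `coker a` the maps `l` and `r` square to `-1`. The cohomology of `𝓛` is the
`-i`-eigenspace there and that of the conjugate is the `+i`-eigenspace, so `ρ ⊕ ρ̄` is a
quasi-isomorphism (`isQuasiIso_eigenAnchor`).

By `v ↦ v + iJv` the real bundle underlying `B` is `TX ⊕ A`, and all operations on it are fixed
formulas in the given structure maps. No choice is made, so isomorphisms lift by acting on `TX` and
on `A`. -/

noncomputable section

namespace HomotopyHolomorphic

/-! ### The Lie algebra of vector fields -/

section VectorFieldCalculus

variable {n : ℕ} {X Y Z : SmoothManifold.{u} n}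

instance (X : SmoothManifold.{u} n) : IsManifold (𝓡 n) (minSmoothness ℝ 2) X := by
  rw [minSmoothness_of_isRCLikeNormedField]; infer_instance

instance (X : SmoothManifold.{u} n) : IsManifold (𝓡 n) (minSmoothness ℝ 3) X := by
  rw [minSmoothness_of_isRCLikeNormedField]; infer_instance

theorem minSmoothness_two_le_infty : minSmoothness ℝ 2 ≤ ∞ := by
  rw [minSmoothness_of_isRCLikeNormedField]
  exact WithTop.coe_le_coe.2 (le_top : (2 : ℕ∞) ≤ ⊤)

namespace VField

theorem mdifferentiableAt (V : VField X) (x : X) :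
    MDifferentiableAt (𝓡 n) (𝓡 n).tangent (fun y => (⟨y, V y⟩ : TangentBundle (𝓡 n) X)) x :=
  (V.contMDiff x).mdifferentiableAt (by simp)

theorem bracket_add_left (U V W : VField X) :
    (U + V).bracket W = U.bracket W + V.bracket W := by
  ext x
  exact VectorField.mlieBracket_add_left (U.mdifferentiableAt x) (V.mdifferentiableAt x)

theorem bracket_add_right (U V W : VField X) :
    U.bracket (V + W) = U.bracket V + U.bracket W := by
  ext x
  exact VectorField.mlieBracket_add_right (V.mdifferentiableAt x) (W.mdifferentiableAt x)

theorem bracket_const_smul_left (c : ℝ) (V W : VField X) :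
    (c • V).bracket W = c • V.bracket W := by
  ext x
  exact VectorField.mlieBracket_const_smul_left (V.mdifferentiableAt x)

theorem bracket_const_smul_right (c : ℝ) (V W : VField X) :
    V.bracket (c • W) = c • V.bracket W := by
  ext x
  exact VectorField.mlieBracket_const_smul_right (W.mdifferentiableAt x)

theorem bracket_swap (V W : VField X) : V.bracket W = -W.bracket V := by
  ext x
  exact VectorField.mlieBracket_swap_apply

theorem bracket_jacobi (U V W : VField X) :
    U.bracket (V.bracket W) = (U.bracket V).bracket W + V.bracket (U.bracket W) := by
  ext x
  exact VectorField.leibniz_identity_mlieBracket_apply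
    ((U.contMDiff x).of_le minSmoothness_two_le_infty)
    ((V.contMDiff x).of_le minSmoothness_two_le_infty)
    ((W.contMDiff x).of_le minSmoothness_two_le_infty)

theorem bracket_smul_right (V : VField X) (f : SmoothFun X) (W : VField X) :
    V.bracket (f • W) = f • V.bracket W + V.deriv f • W := by
  ext x
  exact (VectorField.mlieBracket_smul_right ((f.contMDiff x).mdifferentiableAt (by simp))
    (W.mdifferentiableAt x)).trans (add_comm _ _)

/-- The Lie bracket of vector fields as a bilinear map. -/
def bracketₗ (X : SmoothManifold.{u} n) : VField X →ₗ[ℝ] VField X →ₗ[ℝ] VField X :=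
  LinearMap.mk₂ ℝ bracket bracket_add_left bracket_const_smul_left bracket_add_right
    bracket_const_smul_right

@[simp] theorem bracketₗ_apply (V W : VField X) : bracketₗ X V W = V.bracket W := rfl

theorem deriv_add (V W : VField X) (f : SmoothFun X) :
    (V + W).deriv f = V.deriv f + W.deriv f := by
  ext x
  exact map_add (mvfderiv (𝓡 n) f x) (V x) (W x)

theorem deriv_sub (V W : VField X) (f : SmoothFun X) :
    (V - W).deriv f = V.deriv f - W.deriv f := by
  ext x
  exact map_sub (mvfderiv (𝓡 n) f x) (V x) (W x)

theorem push_add (e : X ≃ₘ⟮𝓡 n, 𝓡 n⟯ Y) (V W : VField X) :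
    (V + W).push e = V.push e + W.push e := by
  ext x
  exact VectorField.mpullback_add_apply ..

theorem push_smul (e : X ≃ₘ⟮𝓡 n, 𝓡 n⟯ Y) (f : SmoothFun X) (V : VField X) :
    (f • V).push e = f.push e • V.push e := by
  ext x
  exact VectorField.mpullback_smul_apply (g := f) ..

theorem push_bracket (e : X ≃ₘ⟮𝓡 n, 𝓡 n⟯ Y) (V W : VField X) :
    (V.bracket W).push e = (V.push e).bracket (W.push e) := by
  ext x
  exact VectorField.mpullback_mlieBracket (n := ∞) (V.mdifferentiableAt _) (W.mdifferentiableAt _)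
    e.symm.contMDiff.contMDiffAt minSmoothness_two_le_infty

theorem push_of_forall_eq (e : X ≃ₘ⟮𝓡 n, 𝓡 n⟯ X) (he : ∀ x, e x = x) (V : VField X) :
    V.push e = V := by
  have h : (e.symm : X → X) = id := by
    funext x
    exact (he (e.symm x)).symm.trans (e.apply_symm_apply x)
  ext x
  change VectorField.mpullback (𝓡 n) (𝓡 n) e.symm V x = V x
  rw [h, VectorField.mpullback_id]

/-- Push-forward is pull-back along the inverse, so the contravariant law for `mpullback` becomes
covariant; that law needs the derivative of `e.symm` to be invertible. The composite is a third
diffeomorphism given pointwise because compositions of stack isomorphisms are specified in this way.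
-/
theorem push_push (e : X ≃ₘ⟮𝓡 n, 𝓡 n⟯ Y) (e' : Y ≃ₘ⟮𝓡 n, 𝓡 n⟯ Z)
    (e'' : X ≃ₘ⟮𝓡 n, 𝓡 n⟯ Z) (he : ∀ x, e'' x = e' (e x)) (V : VField X) :
    V.push e'' = (V.push e).push e' := by
  have h : (e''.symm : Z → X) = e.symm ∘ e'.symm := by
    funext z
    refine e''.injective ?_
    change e'' (e''.symm z) = e'' (e.symm (e'.symm z))
    rw [e''.apply_symm_apply, he, e.apply_symm_apply, e'.apply_symm_apply]
  ext x
  change VectorField.mpullback (𝓡 n) (𝓡 n) e''.symm V x =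
    VectorField.mpullback (𝓡 n) (𝓡 n) e'.symm (VectorField.mpullback (𝓡 n) (𝓡 n) e.symm V) x
  rw [h]
  simp only [← VectorField.mpullbackWithin_univ]
  refine VectorField.mpullbackWithin_comp_of_left
    (e'.symm.contMDiff.mdifferentiable (by simp) x).mdifferentiableWithinAt
    (Set.mapsTo_univ _ _) (uniqueMDiffWithinAt_univ _) ?_
  rw [mfderivWithin_univ]
  exact ⟨e.symm.mfderivToContinuousLinearEquiv (by simp) _, rfl⟩

/-- The push-forward of vector fields along a diffeomorphism as an isomorphism of groups. -/
def pushEquiv (e : X ≃ₘ⟮𝓡 n, 𝓡 n⟯ Y) : VField X ≃+ VField Y where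
  toFun := push e
  invFun := push e.symm
  left_inv V := by
    rw [← push_push e e.symm (Diffeomorph.refl (𝓡 n) X ∞) (by simp)]
    exact push_of_forall_eq _ (fun _ => rfl) V
  right_inv V := by
    rw [← push_push e.symm e (Diffeomorph.refl (𝓡 n) Y ∞) (by simp)]
    exact push_of_forall_eq _ (fun _ => rfl) V
  map_add' := push_add e

end VField

end VectorFieldCalculus

/-! ### The direct sum of the tangent bundle and a vector bundle -/

namespace SmoothVectorBundle

variable {n : ℕ} {X : SmoothManifold.{u} n} (E : SmoothVectorBundle X)

/-- The vector bundle `TX ⊕ E`. -/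
def tangentSum : SmoothVectorBundle X where
  F := EuclideanSpace ℝ (Fin n) × E.F
  fiber := (TangentSpace (𝓡 n) : X → Type) ×ᵇ E.fiber
  topFiber := fun x => inferInstanceAs (TopologicalSpace (TangentSpace (𝓡 n) x × E.fiber x))
  addCommGroup := fun x => inferInstanceAs (AddCommGroup (TangentSpace (𝓡 n) x × E.fiber x))
  module := fun x => inferInstanceAs (Module ℝ (TangentSpace (𝓡 n) x × E.fiber x))

/-- Smoothness of a section is read off in a trivialisation, and a trivialisation of the direct sum
is the product of those of the summands. -/
theorem contMDiff_tangentSum_iff (s : ∀ x : X, TangentSpace (𝓡 n) x × E.fiber x) :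
    ContMDiff (𝓡 n) ((𝓡 n).prod 𝓘(ℝ, E.tangentSum.F)) ∞
        (fun x => (⟨x, s x⟩ : Bundle.TotalSpace E.tangentSum.F E.tangentSum.fiber)) ↔
      ContMDiff (𝓡 n) ((𝓡 n).prod 𝓘(ℝ, EuclideanSpace ℝ (Fin n))) ∞
        (fun x => (⟨x, (s x).1⟩ : Bundle.TotalSpace (EuclideanSpace ℝ (Fin n))
          (TangentSpace (𝓡 n) : X → Type))) ∧
      ContMDiff (𝓡 n) ((𝓡 n).prod 𝓘(ℝ, E.F)) ∞
        (fun x => (⟨x, (s x).2⟩ : Bundle.TotalSpace E.F E.fiber)) := by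
  rw [ContMDiff, ContMDiff, ContMDiff, ← forall_and]
  refine forall_congr' fun x => ?_
  refine (Bundle.contMDiffAt_section (E := E.tangentSum.fiber) x).trans ?_
  refine Iff.trans ?_ (and_congr (Bundle.contMDiffAt_section x).symm
    (Bundle.contMDiffAt_section x).symm)
  exact contMDiffAt_prod_module_iff _

/-- Sections of `TX ⊕ E` are pairs of a vector field and a section of `E`. -/
def tangentSumEquiv : E.tangentSum.Sec ≃ₗ[SmoothFun X] VField X × E.Sec where
  toFun s := (⟨fun x => (s x).1, ((E.contMDiff_tangentSum_iff s).1 s.contMDiff).1⟩,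
    ⟨fun x => (s x).2, ((E.contMDiff_tangentSum_iff s).1 s.contMDiff).2⟩)
  invFun p := ⟨fun x => (p.1 x, p.2 x),
    (E.contMDiff_tangentSum_iff fun x => (p.1 x, p.2 x)).2 ⟨p.1.contMDiff, p.2.contMDiff⟩⟩
  left_inv _ := rfl
  right_inv _ := rfl
  map_add' _ _ := rfl
  map_smul' _ _ := rfl

theorem tangentSumEquiv_const_smul (c : ℝ) (s : E.tangentSum.Sec) :
    E.tangentSumEquiv (c • s) = c • E.tangentSumEquiv s := rfl

end SmoothVectorBundle

/-! ### The foliation of a homotopy holomorphic structure, over the complex numbers -/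

/-- The complex linear algebra underlying a homotopy holomorphic structure: `T` and `A` stand for
the complexified vector fields and sections, and the equations are those of
`HomotopyHolomorphicStructure`. -/
structure ComplexModel (T A : Type*) [AddCommGroup T] [Module ℂ T] [AddCommGroup A]
    [Module ℂ A] where
  bT : T →ₗ[ℂ] T →ₗ[ℂ] T
  bA : A →ₗ[ℂ] A →ₗ[ℂ] A
  a : A →ₗ[ℂ] T
  D : T →ₗ[ℂ] A →ₗ[ℂ] A
  l : A →ₗ[ℂ] A
  r : T →ₗ[ℂ] T
  S : T →ₗ[ℂ] T →ₗ[ℂ] A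
  Q : T →ₗ[ℂ] A
  bT_swap : ∀ V W, bT V W = -bT W V
  bT_jacobi : ∀ U V W, bT U (bT V W) = bT (bT U V) W + bT V (bT U W)
  bA_swap : ∀ α β, bA α β = -bA β α
  bA_jacobi : ∀ α β γ, bA α (bA β γ) = bA (bA α β) γ + bA β (bA α γ)
  a_bA : ∀ α β, a (bA α β) = bT (a α) (a β)
  S_swap : ∀ V W, S V W = -S W V
  l_Q : ∀ V, l (Q V) = Q (r V)
  a_l : ∀ α, a (l α) = r (a α)
  D_anchor : ∀ α β, bA β (l α) - l (bA β α) = D (a α) β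
  a_D : ∀ V β, bT (a β) (r V) - r (bT (a β) V) = a (D V β)
  D_bA : ∀ V α β, bA β (D V α) - D (bT (a β) V) α - D V (bA β α) =
    bA α (D V β) - D (bT (a α) V) β
  torsion : ∀ V W, a (S V W) + bT (r V) (r W) - r (bT (r V) W + bT V (r W) - r (bT V W)) = 0
  S_anchor : ∀ α V, S (a α) V + D V (l α) - l (D V α) = 0
  D_curvature : ∀ α V W, bA α (S V W) - S (bT (a α) V) W - S V (bT (a α) W) + D W (D V α)
    - D V (D W α) - D (bT (r V) W + bT V (r W) - r (bT V W)) α + l (D (bT V W) α) = 0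
  S_bianchi : ∀ V W Z,
    (-D V (S W Z) - S (bT (r V) W + bT V (r W) - r (bT V W)) Z + l (S (bT V W) Z)) +
    (-D W (S Z V) - S (bT (r W) Z + bT W (r Z) - r (bT W Z)) V + l (S (bT W Z) V)) +
    (-D Z (S V W) - S (bT (r Z) V + bT Z (r V) - r (bT Z V)) W + l (S (bT Z V) W)) = 0
  a_Q : ∀ V, a (Q V) + r (r V) = -V
  Q_a : ∀ α, Q (a α) + l (l α) = -α
  Q_bT : ∀ V α, bA α (Q V) - Q (bT (a α) V) + D (r V) α + l (D V α) = 0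
  D_Q : ∀ V W, D V (Q W) - D W (Q V) + Q (bT (r V) W + bT V (r W) - r (bT V W)) - l (Q (bT V W))
    + S (r V) W + S V (r W) + (2 : ℂ) • l (S V W) = 0

namespace ComplexModel

open Complex (I)

variable {T A : Type*} [AddCommGroup T] [Module ℂ T] [AddCommGroup A] [Module ℂ A]
  (M : ComplexModel T A)

/-- The pairs `(V, β)` with `a β = (r + i) V` and `(l - i) β = -Q V`. -/
structure IsEigen (p : T × A) : Prop where
  r_eq : M.r p.1 = M.a p.2 - I • p.1
  l_eq : M.l p.2 = I • p.2 - M.Q p.1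

/-- The unnormalised second component of the bracket. -/
def preBracket (p q : T × A) : A :=
  M.bA p.2 q.2 + M.D p.1 q.2 - M.D q.1 p.2 - M.S p.1 q.1 + M.Q (M.bT p.1 q.1)

/-- The bracket of the pairs. -/
def bracket (p q : T × A) : T × A :=
  (M.bT p.1 q.1, (-(I / 2)) • M.preBracket p q)

theorem preBracket_eq (p q : T × A) : M.preBracket p q = (2 * I) • (M.bracket p q).2 := by
  rw [bracket, smul_smul, show 2 * I * -(I / 2) = 1 by linear_combination -Complex.I_mul_I,
    one_smul]

theorem bracket_swap (p q : T × A) : M.bracket p q = -M.bracket q p := by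
  ext
  · exact M.bT_swap _ _
  · simp only [bracket, preBracket, Prod.snd_neg, M.bT_swap p.1 q.1, M.bA_swap p.2 q.2,
      M.S_swap p.1 q.1, map_neg]
    module

theorem bracket_add_left (p p' q : T × A) :
    M.bracket (p + p') q = M.bracket p q + M.bracket p' q := by
  ext
  · simp [bracket]
  · simp only [bracket, preBracket, Prod.fst_add, Prod.snd_add, map_add, LinearMap.add_apply]
    module

theorem bracket_smul_left (c : ℂ) (p q : T × A) : M.bracket (c • p) q = c • M.bracket p q := by
  ext
  · simp [bracket]
  · simp only [bracket, preBracket, Prod.smul_fst, Prod.smul_snd, map_smul, LinearMap.smul_apply]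
    module

theorem bracket_smul_right (c : ℂ) (p q : T × A) : M.bracket p (c • q) = c • M.bracket p q := by
  rw [bracket_swap, bracket_smul_left, bracket_swap M q, smul_neg, neg_neg]

theorem bracket_add_right (p q q' : T × A) :
    M.bracket p (q + q') = M.bracket p q + M.bracket p q' := by
  rw [bracket_swap, bracket_add_left, bracket_swap M q, bracket_swap M q', neg_add, neg_neg,
    neg_neg]

variable {M}

/-! ### Closure of the eigenpairs under the bracket -/

theorem IsEigen.a_eq {p : T × A} (hp : M.IsEigen p) : M.a p.2 = M.r p.1 + I • p.1 := by
  rw [hp.r_eq, sub_add_cancel]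

/-- `D_anchor`, `Q_bT` and `S_anchor` move `l` past the bracket of `A` and the two `D`-terms, and
the eigenvalue equations then eliminate `a` and `l` on the second components. The left side is skew
in `p` and `q` while the right side is not visibly so; this discrepancy is the input of
`IsEigen.D_Q`. -/
theorem IsEigen.l_preBracket {p q : T × A} (hp : M.IsEigen p) (hq : M.IsEigen q) :
    M.l (M.preBracket p q) = I • M.preBracket p q - M.Q (M.bT (M.r p.1) q.1)
      - (2 * I) • M.Q (M.bT p.1 q.1) - M.D p.1 (M.Q q.1) - M.S p.1 (M.r q.1) - M.l (M.S p.1 q.1)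
      + M.l (M.Q (M.bT p.1 q.1)) := by
  have h₁ := M.D_anchor q.2 p.2
  have h₂ := M.Q_bT q.1 p.2
  have h₃ := M.S_anchor q.2 p.1
  have h₄ := M.S_swap p.1 (M.r q.1)
  have h₅ := M.S_swap p.1 q.1
  simp only [hq.l_eq, hp.a_eq, hq.a_eq, map_add, map_sub, map_smul, LinearMap.add_apply,
    LinearMap.smul_apply] at h₁ h₂ h₃
  simp only [preBracket, map_add, map_sub]
  linear_combination (norm := module) (-1 : ℂ) • h₁ - h₂ - h₃ + h₄ + I • h₅

/-- The asymmetric form of the compatibility of `Q` and `S`. -/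
theorem IsEigen.D_Q {p q : T × A} (hp : M.IsEigen p) (hq : M.IsEigen q) :
    M.D p.1 (M.Q q.1) = -M.Q (M.bT (M.r p.1) q.1) + M.l (M.Q (M.bT p.1 q.1)) - M.S p.1 (M.r q.1)
      - M.l (M.S p.1 q.1) := by
  -- The sum of the two formulas for `l` of the skew `preBracket` gives the symmetric part of `D_V
  -- (QW)`; the structure equation gives the skew part. Half the sum isolates one term.
  have h₁ := hp.l_preBracket hq
  have h₂ := hq.l_preBracket hp
  have h₃ := M.D_Q p.1 q.1
  have h₄ := M.l_Q (M.bT p.1 q.1)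
  have h₅ := M.S_swap q.1 (M.r p.1)
  have h₆ : M.preBracket q p = -M.preBracket p q := by
    rw [preBracket_eq, bracket_swap, Prod.snd_neg, smul_neg, ← preBracket_eq]
  rw [h₆, M.bT_swap q.1 p.1, M.bT_swap (M.r q.1) p.1, M.S_swap q.1 p.1] at h₂
  simp only [map_neg, map_add, map_sub] at h₂ h₃
  linear_combination (norm := module) (1 / 2 : ℂ) • (h₁ + h₂ + h₃ - h₄ - h₅)

theorem IsEigen.bracket {p q : T × A} (hp : M.IsEigen p) (hq : M.IsEigen q) :
    M.IsEigen (M.bracket p q) where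
  r_eq := by
    have h₁ := M.torsion p.1 q.1
    have h₂ := M.a_D q.1 p.2
    have h₃ := M.a_D p.1 q.2
    have h₄ := M.a_bA p.2 q.2
    have h₅ := M.a_Q (M.bT p.1 q.1)
    have h₆ := M.bT_swap (M.a q.2) (M.r p.1)
    have h₇ := M.bT_swap (M.a q.2) p.1
    rw [h₆, h₇] at h₃
    simp only [hp.a_eq, hq.a_eq, map_add, map_sub, map_smul, map_neg, LinearMap.add_apply,
      LinearMap.smul_apply] at h₁ h₂ h₃ h₄
    -- This is the torsion equation with `r` replaced by `a - i` on both arguments; it fixes the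
    -- factor `2i` in the normalisation.
    have h : M.a (M.preBracket p q) = (2 * I) • (M.r (M.bT p.1 q.1) + I • M.bT p.1 q.1) := by
      simp only [preBracket, map_add, map_sub, smul_add, smul_smul, mul_assoc, Complex.I_mul_I]
      simp only [smul_add, smul_smul, Complex.I_mul_I] at h₄
      linear_combination (norm := module) h₄ - h₃ + h₂ - h₁ + h₅
    rw [preBracket_eq, map_smul] at h
    have h' := smul_right_injective T (r := 2 * I) (by simp) h
    rw [h']
    exact (add_sub_cancel_right _ _).symm
  l_eq := by
    have h₁ := hp.l_preBracket hq
    rw [hp.D_Q hq] at h₁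
    have h : M.l (M.preBracket p q) = I • M.preBracket p q - (2 * I) • M.Q (M.bT p.1 q.1) := by
      linear_combination (norm := module) h₁
    rw [preBracket_eq, map_smul, smul_comm, ← smul_sub] at h
    exact smul_right_injective A (r := 2 * I) (by simp) h

/-! ### The Jacobi identity on eigenpairs -/

variable (M) in
theorem two_I_smul_preBracket_bracket (p q s : T × A) :
    (2 * I) • M.preBracket p (M.bracket q s) =
      M.bA p.2 (M.preBracket q s) + M.D p.1 (M.preBracket q s)
        + (2 * I) • (M.Q (M.bT p.1 (M.bT q.1 s.1)) - M.D (M.bT q.1 s.1) p.2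
          - M.S p.1 (M.bT q.1 s.1)) := by
  rw [preBracket_eq M q s, map_smul, map_smul]
  simp only [preBracket, HomotopyHolomorphic.ComplexModel.bracket]
  module

variable (M) in
theorem bT_jacobi_cyclic (U V W : T) :
    M.bT U (M.bT V W) + M.bT V (M.bT W U) + M.bT W (M.bT U V) = 0 := by
  rw [M.bT_jacobi U V W, M.bT_swap W U, M.bT_swap W (M.bT U V), map_neg]
  abel

variable (M) in
theorem bA_jacobi_cyclic (α β γ : A) :
    M.bA α (M.bA β γ) + M.bA β (M.bA γ α) + M.bA γ (M.bA α β) = 0 := by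
  rw [M.bA_jacobi α β γ, M.bA_swap γ α, M.bA_swap γ (M.bA α β), map_neg]
  abel

/-- The Jacobiator is expanded after multiplication by `2i`, which removes the denominators of the
inner brackets. It is then a combination of the Jacobi identities of `T` and `A` and of the
structure equations. `IsEigen.D_Q` is applied to a pair one member of which is itself a bracket, so
closure under the bracket is needed first. -/
theorem IsEigen.preBracket_cyclic {p q s : T × A} (hp : M.IsEigen p) (hq : M.IsEigen q)
    (hs : M.IsEigen s) :
    M.preBracket p (M.bracket q s) + M.preBracket q (M.bracket s p)
      + M.preBracket s (M.bracket p q) = 0 := by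
  refine (smul_eq_zero_iff_right (show (2 * I : ℂ) ≠ 0 by simp)).1 ?_
  rw [smul_add, smul_add, two_I_smul_preBracket_bracket, two_I_smul_preBracket_bracket,
    two_I_smul_preBracket_bracket]
  have q₁ := hp.D_Q (hq.bracket hs)
  have q₂ := hq.D_Q (hs.bracket hp)
  have q₃ := hs.D_Q (hp.bracket hq)
  simp only [HomotopyHolomorphic.ComplexModel.bracket] at q₁ q₂ q₃
  have ap := hp.a_eq
  have aq := hq.a_eq
  have az := hs.a_eq
  simp only [preBracket]
  clear hp hq hs
  obtain ⟨V, β⟩ := p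
  obtain ⟨W, η⟩ := q
  obtain ⟨Z, ζ⟩ := s
  dsimp only at *
  -- Each family removes one kind of nested term: `j₁` the double brackets in `A`, `j₂` and `j₃`
  -- those in `T` under `Q` and `lQ`, `c` the terms `[β, S]` and `DD`, `d` the terms `[β, D]`, `e`
  -- the terms `[β, Q]`, `b` the terms `DS`, and `q` the terms `DQ`.
  have j₁ := M.bA_jacobi_cyclic β η ζ
  have j₂ := congrArg M.Q (M.bT_jacobi_cyclic V W Z)
  have j₃ := congrArg M.l j₂
  have c₁ := M.D_curvature β W Z
  have c₂ := M.D_curvature η Z V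
  have c₃ := M.D_curvature ζ V W
  have d₁ := M.D_bA V ζ η
  have d₂ := M.D_bA W β ζ
  have d₃ := M.D_bA Z η β
  have e₁ := M.Q_bT (M.bT W Z) β
  have e₂ := M.Q_bT (M.bT Z V) η
  have e₃ := M.Q_bT (M.bT V W) ζ
  have b := M.S_bianchi V W Z
  -- The anchors are replaced by `r + i`, and the listed instances of skewness bring the arguments
  -- into one fixed order, so that what remains is linear in the surviving terms.
  simp only [ap, aq, az, map_add, map_sub, map_smul, map_neg, map_zero, LinearMap.add_apply,
    LinearMap.sub_apply, LinearMap.smul_apply, LinearMap.neg_apply, smul_neg,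
    M.bT_swap W V, M.bT_swap Z W, M.bT_swap V Z,
    M.bT_swap (M.r W) V, M.bT_swap (M.r Z) W, M.bT_swap (M.r V) Z,
    M.S_swap V (M.bT W Z), M.S_swap W (M.bT Z V), M.S_swap Z (M.bT V W),
    M.S_swap V (M.bT W (M.r Z)), M.S_swap W (M.bT Z (M.r V)), M.S_swap Z (M.bT V (M.r W)),
    M.S_swap V (M.r (M.bT W Z)), M.S_swap W (M.r (M.bT Z V)), M.S_swap Z (M.r (M.bT V W))]
    at j₂ j₃ c₁ c₂ c₃ d₁ d₂ d₃ e₁ e₂ e₃ b q₁ q₂ q₃ ⊢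
  linear_combination (norm := module) j₁ + (3 * I) • j₂ + j₃ - c₁ - c₂ - c₃ - d₁ - d₂ - d₃
    + e₁ + e₂ + e₃ + b + q₁ + q₂ + q₃

theorem IsEigen.jacobi {p q s : T × A} (hp : M.IsEigen p) (hq : M.IsEigen q)
    (hs : M.IsEigen s) :
    M.bracket p (M.bracket q s) = M.bracket (M.bracket p q) s + M.bracket q (M.bracket p s) := by
  ext
  · exact M.bT_jacobi _ _ _
  · rw [M.bracket_swap (M.bracket p q) s, M.bracket_swap p s, ← neg_one_smul ℂ (M.bracket s p),
      bracket_smul_right]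
    have h := hp.preBracket_cyclic hq hs
    simp only [HomotopyHolomorphic.ComplexModel.bracket, Prod.snd_add, Prod.snd_neg,
      Prod.smul_snd] at h ⊢
    linear_combination (norm := module) (-(I / 2)) • h

/-! ### The morphism from `A` and the equivariance of the homotopy -/

variable (M) in
/-- The morphism from `A` to the pairs. -/
def φ : A →ₗ[ℂ] T × A := M.a.prod (M.l + I • LinearMap.id)

variable (M) in
theorem φ_apply (α : A) : M.φ α = (M.a α, M.l α + I • α) := rfl

variable (M) in
theorem isEigen_φ (α : A) : M.IsEigen (M.φ α) where
  r_eq := by simp [φ_apply, M.a_l]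
  l_eq := by
    have h := M.Q_a α
    simp only [φ_apply, map_add, map_smul, smul_add, smul_smul, Complex.I_mul_I]
    linear_combination (norm := module) h

/-- The second component of this formula is the equivariance condition on `γ`. Both orders of
`D_anchor` enter, since `l` acts on either argument of the bracket of `A`. -/
theorem IsEigen.bracket_φ {p : T × A} (hp : M.IsEigen p) (α : A) :
    M.bracket p (M.φ α) = (M.bT p.1 (M.a α), M.D p.1 α + M.bA p.2 α) := by
  ext
  · rfl
  · refine smul_right_injective A (r := 2 * I) (by simp) ?_
    dsimp only
    rw [← preBracket_eq]
    have h₁ := M.D_anchor α p.2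
    have h₂ := M.S_anchor α p.1
    have h₃ := M.Q_bT p.1 α
    have h₄ := M.D_anchor p.2 α
    have h₅ := M.S_swap p.1 (M.a α)
    have h₆ := congrArg M.Q (M.bT_swap p.1 (M.a α))
    have h₇ := M.bA_swap p.2 α
    have h₈ := congrArg M.l h₇
    rw [hp.r_eq] at h₃
    rw [hp.l_eq] at h₄
    simp only [preBracket, φ_apply, map_add, map_sub, map_smul, map_neg, LinearMap.sub_apply,
      LinearMap.smul_apply] at *
    linear_combination (norm := module) h₁ + h₂ + h₃ + h₄ - h₅ + h₆ - I • h₇ + h₈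

variable (M) in
theorem φ_bA (α β : A) : M.φ (M.bA α β) = M.bracket (M.φ α) (M.φ β) := by
  rw [(M.isEigen_φ α).bracket_φ]
  ext
  · exact M.a_bA α β
  · have h := M.D_anchor α β
    have h₁ := M.bA_swap β (M.l α)
    have h₂ := congrArg M.l (M.bA_swap β α)
    simp only [φ_apply, map_add, map_smul, map_neg, LinearMap.add_apply,
      LinearMap.smul_apply] at *
    linear_combination (norm := module) h - h₁ + h₂

end ComplexModel

/-! ### Complexification of real vector spaces and of bilinear maps -/

/-- The complexification `M ⊕ iM` of a real vector space. -/
@[ext]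
structure Complexified (M : Type*) where
  re : M
  im : M

namespace Complexified

variable {M N P : Type*} [AddCommGroup M] [AddCommGroup N] [AddCommGroup P]

/-- Elements of the complexification as pairs. -/
def equivProd (M : Type*) : Complexified M ≃ M × M where
  toFun x := (x.re, x.im)
  invFun p := ⟨p.1, p.2⟩

instance : AddCommGroup (Complexified M) := (equivProd M).addCommGroup

@[simp] theorem re_add (x y : Complexified M) : (x + y).re = x.re + y.re := rfl
@[simp] theorem im_add (x y : Complexified M) : (x + y).im = x.im + y.im := rfl
@[simp] theorem re_sub (x y : Complexified M) : (x - y).re = x.re - y.re := rfl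
@[simp] theorem im_sub (x y : Complexified M) : (x - y).im = x.im - y.im := rfl
@[simp] theorem re_neg (x : Complexified M) : (-x).re = -x.re := rfl
@[simp] theorem im_neg (x : Complexified M) : (-x).im = -x.im := rfl
@[simp] theorem re_zero : (0 : Complexified M).re = 0 := rfl
@[simp] theorem im_zero : (0 : Complexified M).im = 0 := rfl

/-- Real elements of the complexification. -/
def ofReal (x : M) : Complexified M := ⟨x, 0⟩

@[simp] theorem re_ofReal (x : M) : (ofReal x).re = x := rfl
@[simp] theorem im_ofReal (x : M) : (ofReal x).im = 0 := rfl

variable [Module ℝ M] [Module ℝ N] [Module ℝ P]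

instance : SMul ℂ (Complexified M) :=
  ⟨fun c x => ⟨c.re • x.re - c.im • x.im, c.re • x.im + c.im • x.re⟩⟩

@[simp] theorem re_smul (c : ℂ) (x : Complexified M) :
    (c • x).re = c.re • x.re - c.im • x.im := rfl
@[simp] theorem im_smul (c : ℂ) (x : Complexified M) :
    (c • x).im = c.re • x.im + c.im • x.re := rfl

instance : Module ℂ (Complexified M) where
  one_smul x := by ext <;> simp
  mul_smul c d x := by ext <;> simp <;> module
  smul_zero c := by ext <;> simp
  smul_add c x y := by ext <;> simp <;> module
  add_smul c d x := by ext <;> simp <;> module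
  zero_smul x := by ext <;> simp

/-- The complex linear extension of a real linear map. -/
def map (f : M →ₗ[ℝ] N) : Complexified M →ₗ[ℂ] Complexified N where
  toFun x := ⟨f x.re, f x.im⟩
  map_add' x y := by ext <;> simp
  map_smul' c x := by ext <;> simp

@[simp] theorem re_map (f : M →ₗ[ℝ] N) (x : Complexified M) : (map f x).re = f x.re := rfl
@[simp] theorem im_map (f : M →ₗ[ℝ] N) (x : Complexified M) : (map f x).im = f x.im := rfl

/-- The complex bilinear extension of a real bilinear map. -/
def map₂ (f : M →ₗ[ℝ] N →ₗ[ℝ] P) :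
    Complexified M →ₗ[ℂ] Complexified N →ₗ[ℂ] Complexified P :=
  LinearMap.mk₂ ℂ (fun x y => ⟨f x.re y.re - f x.im y.im, f x.re y.im + f x.im y.re⟩)
    (fun x x' y => by ext <;> simp <;> abel)
    (fun c x y => by ext <;> simp <;> module)
    (fun x y y' => by ext <;> simp <;> abel)
    (fun c x y => by ext <;> simp <;> module)

@[simp] theorem re_map₂ (f : M →ₗ[ℝ] N →ₗ[ℝ] P) (x : Complexified M) (y : Complexified N) :
    (map₂ f x y).re = f x.re y.re - f x.im y.im := rfl
@[simp] theorem im_map₂ (f : M →ₗ[ℝ] N →ₗ[ℝ] P) (x : Complexified M) (y : Complexified N) :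
    (map₂ f x y).im = f x.re y.im + f x.im y.re := rfl

end Complexified

/-! ### The equations of a homotopy holomorphic structure -/

section SectionScalars

variable {n : ℕ} {X : SmoothManifold.{u} n} {F : Type*} [NormedAddCommGroup F] [NormedSpace ℝ F]
  {V : X → Type*} [TopologicalSpace (Bundle.TotalSpace F V)] [∀ x, TopologicalSpace (V x)]
  [FiberBundle F V] [∀ x, AddCommGroup (V x)] [∀ x, Module ℝ (V x)] [VectorBundle ℝ F V]

/-- This compatibility allows `C^∞(X)`-linear maps to be restricted to real scalars before
complexification. -/
instance sectionScalarTower : IsScalarTower ℝ (SmoothFun X) Cₛ^∞⟮𝓡 n; F, V⟯ where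
  smul_assoc c f s := by ext x; exact smul_assoc c (f x) (s x)

end SectionScalars

theorem LieAlgebroid.bracket_swap {n : ℕ} {X : SmoothManifold.{u} n} (A : LieAlgebroid X)
    (α β : A.Sec) : A.bracket α β = -A.bracket β α := by
  have h := A.bracket_self (α + β)
  simp only [map_add, LinearMap.add_apply, A.bracket_self, zero_add, add_zero] at h
  exact eq_neg_of_add_eq_zero_right h

theorem CoreForm2.swap {n : ℕ} {X : SmoothManifold.{u} n} {A : LieAlgebroid X} (S : CoreForm2 A)
    (V W : VField X) : S.toLin V W = -S.toLin W V := by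
  have h := S.alt (V + W)
  simp only [map_add, LinearMap.add_apply, S.alt, zero_add, add_zero] at h
  exact eq_neg_of_add_eq_zero_right h

namespace HomotopyHolomorphicStructure

variable {n : ℕ} {X : SmoothManifold.{u} n} {A : LieAlgebroid X}
  (H : HomotopyHolomorphicStructure A)

theorem l_Q (V : VField X) : H.I₁.l (H.Q₁ V) = H.Q₁ (H.I₁.r V) :=
  sub_eq_zero.1 (congrFun H.commute V)

theorem a_l (α : A.Sec) : A.anchor (H.I₁.l α) = H.I₁.r (A.anchor α) :=
  sub_eq_zero.1 (congrFun (congrArg Prod.snd H.maurerCartan₁) α)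

theorem D_bracket (V : VField X) (α β : A.Sec) :
    A.bracket β (H.I₁.D V α) - H.I₁.D ((A.anchor β).bracket V) α - H.I₁.D V (A.bracket β α) =
      A.bracket α (H.I₁.D V β) - H.I₁.D ((A.anchor α).bracket V) β :=
  sub_eq_zero.1 (congrFun (congrFun (congrArg Prod.fst
    (congrFun (congrArg Prod.fst H.maurerCartan₁) β)) V) α)

theorem D_anchor (α β : A.Sec) :
    A.bracket β (H.I₁.l α) - H.I₁.l (A.bracket β α) = H.I₁.D (A.anchor α) β :=
  sub_eq_zero.1 (congrFun (congrArg (fun t => t.2.1)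
    (congrFun (congrArg Prod.fst H.maurerCartan₁) β)) α)

theorem a_D (V : VField X) (β : A.Sec) :
    (A.anchor β).bracket (H.I₁.r V) - H.I₁.r ((A.anchor β).bracket V) =
      A.anchor (H.I₁.D V β) :=
  sub_eq_zero.1 (congrFun (congrArg (fun t => t.2.2)
    (congrFun (congrArg Prod.fst H.maurerCartan₁) β)) V)

theorem D_curvature (α : A.Sec) (V W : VField X) :
    A.bracket α (H.I₂.toLin V W) - H.I₂.toLin ((A.anchor α).bracket V) W
      - H.I₂.toLin V ((A.anchor α).bracket W)
      + (H.I₁.D W (H.I₁.D V α) - H.I₁.D V (H.I₁.D W α) - H.I₁.D (H.I₁.rBracket V W) α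
        + H.I₁.l (H.I₁.D (V.bracket W) α)) = 0 :=
  congrFun (congrFun (congrFun (congrArg Prod.fst H.maurerCartan₂) α) V) W

theorem S_anchor (α : A.Sec) (V : VField X) :
    H.I₂.toLin (A.anchor α) V + (H.I₁.D V (H.I₁.l α) - H.I₁.l (H.I₁.D V α)) = 0 :=
  congrFun (congrFun (congrArg (fun t => t.2.1) H.maurerCartan₂) α) V

theorem torsion (V W : VField X) :
    A.anchor (H.I₂.toLin V W)
      + ((H.I₁.r V).bracket (H.I₁.r W) - H.I₁.r (H.I₁.rBracket V W)) = 0 :=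
  congrFun (congrFun (congrArg (fun t => t.2.2) H.maurerCartan₂) V) W

theorem Q_bracket (V : VField X) (α : A.Sec) :
    A.bracket α (H.Q₁ V) - H.Q₁ ((A.anchor α).bracket V)
      + (H.I₁.D (H.I₁.r V) α + H.I₁.l (H.I₁.D V α)) = 0 :=
  (congrFun (congrFun (congrArg Prod.fst H.square₁) V) α).trans neg_zero

theorem Q_a (α : A.Sec) : H.Q₁ (A.anchor α) + H.I₁.l (H.I₁.l α) = -α :=
  congrFun (congrArg (fun t => t.2.1) H.square₁) α

theorem a_Q (V : VField X) : A.anchor (H.Q₁ V) + H.I₁.r (H.I₁.r V) = -V :=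
  congrFun (congrArg (fun t => t.2.2) H.square₁) V

theorem D_Q (V W : VField X) :
    H.I₁.D V (H.Q₁ W) - H.I₁.D W (H.Q₁ V) + H.Q₁ (H.I₁.rBracket V W)
      - H.I₁.l (H.Q₁ (V.bracket W))
      + ((H.I₁.l (H.I₂.toLin V W) - H.I₁.l (H.I₂.toLin W V))
        + (H.I₂.toLin (H.I₁.r V) W - H.I₂.toLin (H.I₁.r W) V)) = 0 :=
  congrFun (congrFun H.square₂ V) W

theorem S_bianchi (V W Z : VField X) :
    (-H.I₁.D V (H.I₂.toLin W Z) - H.I₂.toLin (H.I₁.rBracket V W) Z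
        + H.I₁.l (H.I₂.toLin (V.bracket W) Z)) +
      (-H.I₁.D W (H.I₂.toLin Z V) - H.I₂.toLin (H.I₁.rBracket W Z) V
        + H.I₁.l (H.I₂.toLin (W.bracket Z) V)) +
      (-H.I₁.D Z (H.I₂.toLin V W) - H.I₂.toLin (H.I₁.rBracket Z V) W
        + H.I₁.l (H.I₂.toLin (Z.bracket V) W)) = 0 :=
  congrFun (congrFun (congrFun H.maurerCartan₃ V) W) Z

/-- `𝓘₂` as a real bilinear map. -/
def S₂ : VField X →ₗ[ℝ] VField X →ₗ[ℝ] A.Sec :=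
  LinearMap.mk₂ ℝ (fun V W => H.I₂.toLin V W) (by simp)
    (fun c V W => by
      rw [← algebraMap_smul (SmoothFun X) c V, map_smul, LinearMap.smul_apply, algebraMap_smul])
    (by simp) (fun c V W => LinearMap.map_smul_of_tower _ c W)

/-- The operator `D` of `𝓘₁` as a real bilinear map. -/
def D₂ : VField X →ₗ[ℝ] A.Sec →ₗ[ℝ] A.Sec :=
  LinearMap.mk₂ ℝ (fun V α => H.I₁.D V α) (by simp)
    (fun c V α => by
      rw [← algebraMap_smul (SmoothFun X) c V, map_smul, LinearMap.smul_apply, algebraMap_smul])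
    (by simp) (by simp)

@[simp] theorem S₂_apply (V W : VField X) : H.S₂ V W = H.I₂.toLin V W := rfl
@[simp] theorem D₂_apply (V : VField X) (α : A.Sec) : H.D₂ V α = H.I₁.D V α := rfl

end HomotopyHolomorphicStructure

namespace HomotopyHolomorphicStructure

open Complexified

variable {n : ℕ} {X : SmoothManifold.{u} n} {A : LieAlgebroid X}
  (H : HomotopyHolomorphicStructure A)

set_option linter.unusedSimpArgs false in
set_option maxHeartbeats 1000000 in
/-- The complexification of a homotopy holomorphic structure. -/
def complexModel : ComplexModel (Complexified (VField X)) (Complexified A.Sec) where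
  bT := map₂ (VField.bracketₗ X)
  bA := map₂ A.bracket
  a := map (A.anchor.restrictScalars ℝ)
  D := map₂ H.D₂
  l := map (H.I₁.l.restrictScalars ℝ)
  r := map (H.I₁.r.restrictScalars ℝ)
  S := map₂ H.S₂
  Q := map (H.Q₁.restrictScalars ℝ)
  bT_swap V W := by
    have h := VField.bracket_swap (X := X)
    ext1
    · simp only [re_map₂, re_neg, VField.bracketₗ_apply]
      linear_combination (norm := module) h V.re W.re - h V.im W.im
    · simp only [im_map₂, im_neg, VField.bracketₗ_apply]
      linear_combination (norm := module) h V.re W.im + h V.im W.re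
  bT_jacobi U V W := by
    have h (U V W : VField X) := VField.bracket_jacobi U V W
    simp only [← VField.bracketₗ_apply] at h
    ext1
    · simp only [re_map₂, im_map₂, re_add, map_add, map_sub, LinearMap.add_apply,
        LinearMap.sub_apply]
      -- The real part of a trilinear identity collects the choices with an even number of imaginary
      -- arguments, two of them contributing the sign `-1`; the imaginary part collects the odd
      -- choices. The other trilinear fields follow the same pattern.
      linear_combination (norm := module) h U.re V.re W.re - h U.re V.im W.im
        - h U.im V.re W.im - h U.im V.im W.re
    · simp only [re_map₂, im_map₂, im_add, map_add, map_sub, LinearMap.add_apply,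
        LinearMap.sub_apply]
      linear_combination (norm := module) h U.re V.re W.im + h U.re V.im W.re
        + h U.im V.re W.re - h U.im V.im W.im
  bA_swap α β := by
    have h := A.bracket_swap
    ext1
    · simp only [re_map₂, re_neg]
      linear_combination (norm := module) h α.re β.re - h α.im β.im
    · simp only [im_map₂, im_neg]
      linear_combination (norm := module) h α.re β.im + h α.im β.re
  bA_jacobi α β γ := by
    have h := A.jacobi
    ext1
    · simp only [re_map₂, im_map₂, re_add, map_add, map_sub, LinearMap.add_apply,
        LinearMap.sub_apply]
      linear_combination (norm := module) h α.re β.re γ.re - h α.re β.im γ.im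
        - h α.im β.re γ.im - h α.im β.im γ.re
    · simp only [re_map₂, im_map₂, im_add, map_add, map_sub, LinearMap.add_apply,
        LinearMap.sub_apply]
      linear_combination (norm := module) h α.re β.re γ.im + h α.re β.im γ.re
        + h α.im β.re γ.re - h α.im β.im γ.im
  a_bA α β := by
    ext1 <;> simp [A.anchor_bracket]
  S_swap V W := by
    have h := H.I₂.swap
    ext1
    · simp only [re_map₂, re_neg, S₂_apply]
      linear_combination (norm := module) h V.re W.re - h V.im W.im
    · simp only [im_map₂, im_neg, S₂_apply]
      linear_combination (norm := module) h V.re W.im + h V.im W.re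
  l_Q V := by ext1 <;> simp [H.l_Q]
  a_l α := by ext1 <;> simp [H.a_l]
  D_anchor α β := by
    have h (α β : A.Sec) := H.D_anchor α β
    simp only [← D₂_apply] at h
    ext1
    · simp only [re_map₂, im_map₂, re_map, im_map, re_sub, map_add, map_sub,
        LinearMap.restrictScalars_apply]
      linear_combination (norm := module) h α.re β.re - h α.im β.im
    · simp only [re_map₂, im_map₂, re_map, im_map, im_sub, map_add, map_sub,
        LinearMap.restrictScalars_apply]
      linear_combination (norm := module) h α.re β.im + h α.im β.re
  a_D V β := by
    have h (V : VField X) (β : A.Sec) := H.a_D V β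
    simp only [← D₂_apply, ← VField.bracketₗ_apply] at h
    ext1
    · simp only [re_map₂, im_map₂, re_map, im_map, re_sub, map_add, map_sub,
        LinearMap.restrictScalars_apply]
      linear_combination (norm := module) h V.re β.re - h V.im β.im
    · simp only [re_map₂, im_map₂, re_map, im_map, im_sub, map_add, map_sub,
        LinearMap.restrictScalars_apply]
      linear_combination (norm := module) h V.re β.im + h V.im β.re
  D_bA V α β := by
    have h (V : VField X) (α β : A.Sec) := H.D_bracket V α β
    simp only [← D₂_apply, ← VField.bracketₗ_apply] at h
    ext1
    · simp only [re_map₂, im_map₂, re_map, im_map, re_sub, map_add, map_sub,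
        LinearMap.restrictScalars_apply, LinearMap.add_apply, LinearMap.sub_apply]
      linear_combination (norm := module) h V.re α.re β.re - h V.re α.im β.im
        - h V.im α.re β.im - h V.im α.im β.re
    · simp only [re_map₂, im_map₂, re_map, im_map, im_sub, map_add, map_sub,
        LinearMap.restrictScalars_apply, LinearMap.add_apply, LinearMap.sub_apply]
      linear_combination (norm := module) h V.re α.re β.im + h V.re α.im β.re
        + h V.im α.re β.re - h V.im α.im β.im
  torsion V W := by
    have h (V W : VField X) := H.torsion V W
    simp only [EndForm.rBracket, ← S₂_apply, ← VField.bracketₗ_apply, map_add, map_sub] at h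
    ext1
    · simp only [re_map₂, im_map₂, re_map, im_map, re_add, im_add, re_sub, im_sub, re_zero,
        map_add, map_sub, LinearMap.restrictScalars_apply]
      linear_combination (norm := module) h V.re W.re - h V.im W.im
    · simp only [re_map₂, im_map₂, re_map, im_map, re_add, im_add, re_sub, im_sub, im_zero,
        map_add, map_sub, LinearMap.restrictScalars_apply]
      linear_combination (norm := module) h V.re W.im + h V.im W.re
  S_anchor α V := by
    have h (α : A.Sec) (V : VField X) := H.S_anchor α V
    simp only [← S₂_apply, ← D₂_apply] at h
    ext1
    · simp only [re_map₂, im_map₂, re_map, im_map, re_add, re_sub, re_zero,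
        map_add, map_sub, LinearMap.restrictScalars_apply]
      linear_combination (norm := module) h α.re V.re - h α.im V.im
    · simp only [re_map₂, im_map₂, re_map, im_map, im_add, im_sub, im_zero,
        map_add, map_sub, LinearMap.restrictScalars_apply]
      linear_combination (norm := module) h α.re V.im + h α.im V.re
  D_curvature α V W := by
    have h (α : A.Sec) (V W : VField X) := H.D_curvature α V W
    simp only [EndForm.rBracket, ← S₂_apply, ← D₂_apply, ← VField.bracketₗ_apply, map_add,
      map_sub, LinearMap.add_apply, LinearMap.sub_apply] at h
    ext1
    · simp only [re_map₂, im_map₂, re_map, im_map, re_add, im_add, re_sub, im_sub, re_zero,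
        map_add, map_sub, LinearMap.restrictScalars_apply, LinearMap.add_apply,
        LinearMap.sub_apply]
      linear_combination (norm := module) h α.re V.re W.re - h α.re V.im W.im
        - h α.im V.re W.im - h α.im V.im W.re
    · simp only [re_map₂, im_map₂, re_map, im_map, re_add, im_add, re_sub, im_sub, im_zero,
        map_add, map_sub, LinearMap.restrictScalars_apply, LinearMap.add_apply,
        LinearMap.sub_apply]
      linear_combination (norm := module) h α.re V.re W.im + h α.re V.im W.re
        + h α.im V.re W.re - h α.im V.im W.im
  S_bianchi V W Z := by
    have h (V W Z : VField X) := H.S_bianchi V W Z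
    simp only [EndForm.rBracket, ← S₂_apply, ← D₂_apply, ← VField.bracketₗ_apply, map_add,
      map_sub, LinearMap.add_apply, LinearMap.sub_apply] at h
    ext1
    · simp only [re_map₂, im_map₂, re_map, im_map, re_add, im_add, re_sub, im_sub, re_neg, re_zero,
        map_add, map_sub, LinearMap.restrictScalars_apply, LinearMap.add_apply,
        LinearMap.sub_apply]
      linear_combination (norm := module) h V.re W.re Z.re - h V.re W.im Z.im
        - h V.im W.re Z.im - h V.im W.im Z.re
    · simp only [re_map₂, im_map₂, re_map, im_map, re_add, im_add, re_sub, im_sub, im_neg, im_zero,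
        map_add, map_sub, LinearMap.restrictScalars_apply, LinearMap.add_apply,
        LinearMap.sub_apply]
      linear_combination (norm := module) h V.re W.re Z.im + h V.re W.im Z.re
        + h V.im W.re Z.re - h V.im W.im Z.im
  a_Q V := by ext1 <;> simp [H.a_Q]
  Q_a α := by ext1 <;> simp [H.Q_a]
  Q_bT V α := by
    have h (V : VField X) (α : A.Sec) := H.Q_bracket V α
    simp only [← D₂_apply, ← VField.bracketₗ_apply] at h
    ext1
    · simp only [re_map₂, im_map₂, re_map, im_map, re_add, re_sub, re_zero,
        map_add, map_sub, LinearMap.restrictScalars_apply]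
      linear_combination (norm := module) h V.re α.re - h V.im α.im
    · simp only [re_map₂, im_map₂, re_map, im_map, im_add, im_sub, im_zero,
        map_add, map_sub, LinearMap.restrictScalars_apply]
      linear_combination (norm := module) h V.re α.im + h V.im α.re
  D_Q V W := by
    have h (V W : VField X) := H.D_Q V W
    -- The Nijenhuis–Richardson bracket is written as a sum over permutations; alternation of `S`
    -- turns it into `S(rV, W) + S(V, rW) + 2 l S(V, W)`.
    have h' (V W : VField X) := H.I₂.swap V (H.I₁.r W)
    have h'' (V W : VField X) := congrArg H.I₁.l (H.I₂.swap V W)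
    simp only [map_neg] at h''
    simp only [EndForm.rBracket, ← S₂_apply, ← D₂_apply, ← VField.bracketₗ_apply, map_add,
      map_sub] at h h' h''
    ext1
    · simp only [re_map₂, im_map₂, re_map, im_map, re_add, im_add, re_sub, im_sub, re_zero,
        re_smul, map_add, map_sub, LinearMap.restrictScalars_apply, Complex.re_ofNat,
        Complex.im_ofNat]
      linear_combination (norm := module) h V.re W.re - h V.im W.im + h' V.re W.re - h' V.im W.im
        + h'' V.re W.re - h'' V.im W.im
    · simp only [re_map₂, im_map₂, re_map, im_map, re_add, im_add, re_sub, im_sub, im_zero,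
        im_smul, map_add, map_sub, LinearMap.restrictScalars_apply, Complex.re_ofNat,
        Complex.im_ofNat]
      linear_combination (norm := module) h V.re W.im + h V.im W.re + h' V.re W.im + h' V.im W.re
        + h'' V.re W.im + h'' V.im W.re

end HomotopyHolomorphicStructure

/-! ### The bundle of eigenvectors

A homotopy holomorphic structure makes `J (V, β) = (r V + a β, Q V - l β)` a complex structure on
`TX ⊕ A`.  Its `-i`-eigenbundle in the complexification is, by `v ↦ v + i J v`, the bundle `TX ⊕ A`
with the complex structure `-J`. -/

namespace HomotopyHolomorphicStructure

open Complexified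
open Complex (I)

variable {n : ℕ} {X : SmoothManifold.{u} n} {A : LieAlgebroid X}
  (H : HomotopyHolomorphicStructure A)

/-- The anchor of the eigenbundle. -/
def eigenAnchor : VField X × A.Sec →ₗ[SmoothFun X] VField X × VField X :=
  (LinearMap.fst _ _ _).prod (H.I₁.r.coprod A.anchor)

/-- The homotopy of the eigenbundle. -/
def eigenγ : VField X × A.Sec →ₗ[SmoothFun X] A.Sec × A.Sec :=
  (-LinearMap.snd _ _ _).prod ((-H.Q₁).coprod H.I₁.l)

/-- The complex structure of the eigenbundle. -/
def eigenJ : VField X × A.Sec →ₗ[SmoothFun X] VField X × A.Sec :=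
  (-H.I₁.r.coprod A.anchor).prod ((-H.Q₁).coprod H.I₁.l)

/-- The map from `A` to the eigenbundle. -/
def eigenφ : A.Sec →ₗ[SmoothFun X] VField X × A.Sec := A.anchor.prod (-H.I₁.l)

theorem eigenAnchor_apply (p : VField X × A.Sec) :
    H.eigenAnchor p = (p.1, H.I₁.r p.1 + A.anchor p.2) := rfl

theorem eigenγ_apply (p : VField X × A.Sec) :
    H.eigenγ p = (-p.2, -H.Q₁ p.1 + H.I₁.l p.2) := rfl

theorem eigenJ_apply (p : VField X × A.Sec) :
    H.eigenJ p = (-(H.I₁.r p.1 + A.anchor p.2), -H.Q₁ p.1 + H.I₁.l p.2) := rfl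

theorem eigenφ_apply (α : A.Sec) : H.eigenφ α = (A.anchor α, -H.I₁.l α) := rfl

/-- The eigenvector of a section of `TX ⊕ A`. -/
def eigenvector (p : VField X × A.Sec) : Complexified (VField X) × Complexified A.Sec :=
  (⟨(H.eigenAnchor p).1, (H.eigenAnchor p).2⟩, ⟨(H.eigenγ p).1, (H.eigenγ p).2⟩)

theorem eigenvector_injective : Function.Injective H.eigenvector := by
  intro p q h
  ext1
  · exact congrArg (fun x => x.1.re) h
  · exact neg_injective (congrArg (fun x => x.2.re) h)

/-- The real parts hold by the form of `v + iJv`; the imaginary parts are the relations that make up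
`J² = -1`. -/
theorem isEigen_eigenvector (p : VField X × A.Sec) : H.complexModel.IsEigen (H.eigenvector p) where
  r_eq := by
    ext1
    · simp [complexModel, eigenvector, eigenAnchor_apply, eigenγ_apply]
    · have h₁ := H.a_Q p.1
      have h₂ := H.a_l p.2
      simp [complexModel, eigenvector, eigenAnchor_apply, eigenγ_apply]
      linear_combination (norm := module) h₁ - h₂
  l_eq := by
    ext1
    · simp [complexModel, eigenvector, eigenAnchor_apply, eigenγ_apply]
    · have h₁ := H.Q_a p.2
      have h₂ := H.l_Q p.1
      simp [complexModel, eigenvector, eigenAnchor_apply, eigenγ_apply]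
      linear_combination (norm := module) h₁ - h₂

/-- The section of `TX ⊕ A` belonging to an eigenvector. -/
def realPart (x : Complexified (VField X) × Complexified A.Sec) : VField X × A.Sec :=
  (x.1.re, -x.2.re)

/-- The real parts of the eigenvalue equations express the imaginary part of an eigenpair through
its real part. Eigenpairs therefore correspond to sections of `TX ⊕ A`, and the complex identities
transfer to these. -/
theorem eigenvector_realPart {x : Complexified (VField X) × Complexified A.Sec}
    (hx : H.complexModel.IsEigen x) : H.eigenvector (realPart x) = x := by
  have h₁ := congrArg re hx.r_eq
  have h₂ := congrArg re hx.l_eq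
  simp [complexModel] at h₁ h₂
  refine Prod.ext (Complexified.ext rfl ?_) (Complexified.ext (neg_neg _) ?_)
  · simp only [eigenvector, eigenAnchor_apply, realPart, map_neg]
    linear_combination (norm := module) h₁
  · simp only [eigenvector, eigenγ_apply, realPart, map_neg]
    linear_combination (norm := module) -h₂

@[simp] theorem realPart_eigenvector (p : VField X × A.Sec) : realPart (H.eigenvector p) = p :=
  Prod.ext rfl (neg_neg p.2)

theorem eigenvector_add (p q : VField X × A.Sec) :
    H.eigenvector (p + q) = H.eigenvector p + H.eigenvector q := by
  ext1 <;> ext1 <;> simp [eigenvector]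

theorem eigenvector_const_smul (c : ℝ) (p : VField X × A.Sec) :
    H.eigenvector (c • p) = (c : ℂ) • H.eigenvector p := by
  ext1 <;> ext1 <;> simp [eigenvector, LinearMap.map_smul_of_tower, -Complex.coe_smul]

theorem eigenvector_J (p : VField X × A.Sec) :
    H.eigenvector (H.eigenJ p) = I • H.eigenvector p := by
  have h : H.complexModel.IsEigen (I • H.eigenvector p) := by
    have h := H.isEigen_eigenvector p
    constructor
    · simp [h.r_eq, smul_sub]
    · simp [h.l_eq, smul_sub]
  rw [← H.eigenvector_realPart h]
  congr 1
  ext1 <;> simp [realPart, eigenvector, eigenJ_apply, eigenAnchor_apply, eigenγ_apply]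

theorem eigenvector_φ (α : A.Sec) :
    H.eigenvector (H.eigenφ α) = H.complexModel.φ (ofReal α) := by
  rw [← H.eigenvector_realPart (H.complexModel.isEigen_φ (ofReal α))]
  congr 1
  ext1 <;> simp [realPart, eigenφ_apply, ComplexModel.φ_apply, complexModel]

theorem realPart_add (x y : Complexified (VField X) × Complexified A.Sec) :
    realPart (x + y) = realPart x + realPart y :=
  Prod.ext rfl (neg_add x.2.re y.2.re)

theorem realPart_ofReal_smul (c : ℝ) (x : Complexified (VField X) × Complexified A.Sec) :
    realPart ((c : ℂ) • x) = c • realPart x := by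
  ext1 <;> simp [realPart, -Complex.coe_smul]

/-- The bracket on sections of the eigenbundle. -/
def eigenBracket : VField X × A.Sec →ₗ[ℝ] VField X × A.Sec →ₗ[ℝ] VField X × A.Sec :=
  LinearMap.mk₂ ℝ
    (fun p q => realPart (H.complexModel.bracket (H.eigenvector p) (H.eigenvector q)))
    (fun p p' q => by rw [eigenvector_add, ComplexModel.bracket_add_left, realPart_add])
    (fun c p q => by
      rw [eigenvector_const_smul, ComplexModel.bracket_smul_left, realPart_ofReal_smul])
    (fun p q q' => by rw [eigenvector_add, ComplexModel.bracket_add_right, realPart_add])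
    (fun c p q => by
      rw [eigenvector_const_smul, ComplexModel.bracket_smul_right, realPart_ofReal_smul])

theorem eigenBracket_apply (p q : VField X × A.Sec) : H.eigenBracket p q =
    realPart (H.complexModel.bracket (H.eigenvector p) (H.eigenvector q)) := rfl

theorem eigenvector_bracket (p q : VField X × A.Sec) : H.eigenvector (H.eigenBracket p q) =
    H.complexModel.bracket (H.eigenvector p) (H.eigenvector q) :=
  H.eigenvector_realPart ((H.isEigen_eigenvector p).bracket (H.isEigen_eigenvector q))

/-! ### Lie algebroid identities on real sections -/

theorem eigenJ_eigenJ (p : VField X × A.Sec) : H.eigenJ (H.eigenJ p) = -p := by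
  apply H.eigenvector_injective
  rw [eigenvector_J, eigenvector_J, smul_smul, Complex.I_mul_I, ← neg_one_smul ℝ p,
    eigenvector_const_smul, Complex.ofReal_neg, Complex.ofReal_one]

theorem eigenBracket_self (p : VField X × A.Sec) : H.eigenBracket p p = 0 := by
  have h := H.complexModel.bracket_swap (H.eigenvector p) (H.eigenvector p)
  have h' : (2 : ℂ) • H.complexModel.bracket (H.eigenvector p) (H.eigenvector p) = 0 := by
    rw [two_smul]
    exact eq_neg_iff_add_eq_zero.1 h
  rw [eigenBracket_apply, (smul_eq_zero_iff_right two_ne_zero).1 h']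
  exact Prod.ext rfl neg_zero

theorem eigenBracket_jacobi (p q s : VField X × A.Sec) :
    H.eigenBracket p (H.eigenBracket q s) =
      H.eigenBracket (H.eigenBracket p q) s + H.eigenBracket q (H.eigenBracket p s) := by
  apply H.eigenvector_injective
  simp only [eigenvector_add, eigenvector_bracket]
  exact (H.isEigen_eigenvector p).jacobi (H.isEigen_eigenvector q) (H.isEigen_eigenvector s)

theorem eigenBracket_J (p q : VField X × A.Sec) :
    H.eigenBracket p (H.eigenJ q) = H.eigenJ (H.eigenBracket p q) := by
  apply H.eigenvector_injective
  simp only [eigenvector_J, eigenvector_bracket, ComplexModel.bracket_smul_right]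

theorem eigenAnchor_J (p : VField X × A.Sec) :
    H.eigenAnchor (H.eigenJ p) = mulI (R := SmoothFun X) (H.eigenAnchor p) := by
  have h := congrArg Prod.fst (H.eigenvector_J p)
  ext1
  · exact (congrArg re h).trans (by simp [eigenvector, mulI])
  · exact (congrArg im h).trans (by simp [eigenvector, mulI])

theorem eigenγ_J (p : VField X × A.Sec) :
    H.eigenγ (H.eigenJ p) = mulI (R := SmoothFun X) (H.eigenγ p) := by
  have h := congrArg Prod.snd (H.eigenvector_J p)
  ext1
  · exact (congrArg re h).trans (by simp [eigenvector, mulI])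
  · exact (congrArg im h).trans (by simp [eigenvector, mulI])

theorem eigenAnchor_bracket (p q : VField X × A.Sec) : H.eigenAnchor (H.eigenBracket p q) =
    ((H.eigenAnchor p).1.bracket (H.eigenAnchor q).1
      - (H.eigenAnchor p).2.bracket (H.eigenAnchor q).2,
     (H.eigenAnchor p).1.bracket (H.eigenAnchor q).2
      + (H.eigenAnchor p).2.bracket (H.eigenAnchor q).1) := by
  have h := congrArg Prod.fst (H.eigenvector_bracket p q)
  exact Prod.ext (congrArg re h) (congrArg im h)

theorem eigenAnchor_φ (α : A.Sec) : H.eigenAnchor (H.eigenφ α) = (A.anchor α, 0) := by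
  have h := congrArg Prod.fst (H.eigenvector_φ α)
  exact Prod.ext (congrArg re h) ((congrArg im h).trans (map_zero A.anchor))

theorem eigenφ_bracket (α β : A.Sec) :
    H.eigenφ (A.bracket α β) = H.eigenBracket (H.eigenφ α) (H.eigenφ β) := by
  apply H.eigenvector_injective
  rw [eigenvector_bracket, H.eigenvector_φ α, H.eigenvector_φ β, H.eigenvector_φ,
    ← ComplexModel.φ_bA]
  congr 1
  ext1 <;> simp [complexModel]

/-- The derivative terms in `preBracket` are `(aβ - rV)(f) η + V(f) (lη + QW)`. The eigenvalue
equations make each summand `i V(f) η`, and the factor `1/(2i)` leaves `V(f) η`. The last pair on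
the right is the real section belonging to `i y`. -/
theorem realPart_bracket_leibniz {x y : Complexified (VField X) × Complexified A.Sec}
    (hx : H.complexModel.IsEigen x) (hy : H.complexModel.IsEigen y) (f : SmoothFun X) :
    realPart (H.complexModel.bracket x
        (⟨f • y.1.re, f • y.1.im⟩, ⟨f • y.2.re, f • y.2.im⟩)) =
      f • realPart (H.complexModel.bracket x y) + x.1.re.deriv f • realPart y
        + x.1.im.deriv f • (-y.1.im, y.2.im) := by
  obtain ⟨⟨V₁, V₂⟩, ⟨β₁, β₂⟩⟩ := x
  obtain ⟨⟨W₁, W₂⟩, ⟨η₁, η₂⟩⟩ := y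
  have d₁ := congrArg re hx.r_eq
  have d₂ := congrArg im hx.r_eq
  have l₁ := congrArg re hy.l_eq
  have l₂ := congrArg im hy.l_eq
  simp [complexModel] at d₁ d₂ l₁ l₂
  ext1
  · simp [realPart, ComplexModel.bracket, complexModel, VField.bracket_smul_right]
    module
  · simp [realPart, ComplexModel.bracket, ComplexModel.preBracket, complexModel, A.leibniz,
      H.I₁.D_leibniz, VField.bracket_smul_right]
    simp only [d₁, d₂, l₁, l₂, VField.deriv_add, VField.deriv_sub]
    -- The coefficients lie in the ring `C^∞(X)`, where `ring1` does not cancel the constant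
    -- function one half against `2`.
    have hc : algebraMap ℝ (SmoothFun X) 2⁻¹ * 2 = 1 := by
      rw [← map_ofNat (algebraMap ℝ (SmoothFun X)) 2, ← map_mul, inv_mul_cancel₀ two_ne_zero,
        map_one]
    match_scalars <;>
      first
      | ring1
      | linear_combination V₂.deriv f * hc
      | linear_combination -V₁.deriv f * hc

theorem eigenBracket_leibniz (p : VField X × A.Sec) (f : SmoothFun X) (q : VField X × A.Sec) :
    H.eigenBracket p (f • q) = f • H.eigenBracket p q + (H.eigenAnchor p).1.deriv f • q
      + (H.eigenAnchor p).2.deriv f • H.eigenJ q := by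
  have h := H.realPart_bracket_leibniz (H.isEigen_eigenvector p) (H.isEigen_eigenvector q) f
  have hf : H.eigenvector (f • q) = (⟨f • (H.eigenvector q).1.re, f • (H.eigenvector q).1.im⟩,
      ⟨f • (H.eigenvector q).2.re, f • (H.eigenvector q).2.im⟩) := by
    ext1 <;> ext1 <;> simp [eigenvector]
  rw [realPart_eigenvector, ← hf] at h
  exact h

/-! ### The homotopy and the quasi-isomorphism -/

theorem eigenAnchor_γ (p : VField X × A.Sec) : tangentD A (H.eigenγ p) =
    H.I₁.r.prodMap H.I₁.r (H.eigenAnchor p) + mulI (R := SmoothFun X) (H.eigenAnchor p) := by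
  have h := (H.isEigen_eigenvector p).a_eq
  exact Prod.ext ((congrArg re h).trans (by simp [eigenvector, complexModel, mulI]))
    ((congrArg im h).trans (by simp [eigenvector, complexModel, mulI]))

theorem eigenγ_bracket_φ (p : VField X × A.Sec) (α : A.Sec) :
    (H.I₁.D (H.eigenAnchor p).1 α, H.I₁.D (H.eigenAnchor p).2 α) =
      H.eigenγ (H.eigenBracket p (H.eigenφ α))
        - (A.bracket (H.eigenγ p).1 α, A.bracket (H.eigenγ p).2 α) := by
  have h := congrArg Prod.snd (H.eigenvector_bracket p (H.eigenφ α))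
  rw [eigenvector_φ, (H.isEigen_eigenvector p).bracket_φ] at h
  have h₁ := congrArg re h
  have h₂ := congrArg im h
  simp [eigenvector, complexModel] at h₁ h₂
  ext1
  · simp [h₁]
  · simp [h₂]

theorem eigenJ_φ (α : A.Sec) : H.eigenJ (H.eigenφ α) = (0, α) := by
  rw [eigenJ_apply, eigenφ_apply]
  ext1
  · simp [H.a_l]
  · have h := H.Q_a α
    simp only [map_neg]
    linear_combination (norm := module) -h

/-- The complex linear extension of `eigenφ`. -/
def eigenD : A.Sec × A.Sec →ₗ[SmoothFun X] VField X × A.Sec :=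
  H.eigenφ.coprod (H.eigenJ ∘ₗ H.eigenφ)

theorem eigenD_apply (p : A.Sec × A.Sec) :
    H.eigenD p = (A.anchor p.1, p.2 - H.I₁.l p.1) := by
  rw [eigenD, LinearMap.coprod_apply, LinearMap.comp_apply, eigenJ_φ, eigenφ_apply, Prod.mk_add_mk,
    add_zero, ← sub_eq_neg_add]

theorem eigenγ_D (p : A.Sec × A.Sec) :
    H.eigenγ (H.eigenD p) = H.I₁.l.prodMap H.I₁.l p + mulI (R := SmoothFun X) p := by
  have h := H.Q_a p.1
  rw [eigenD_apply, eigenγ_apply]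
  ext1
  · simp [mulI, sub_eq_add_neg, add_comm]
  · simp [mulI]
    linear_combination (norm := module) -h

/-- The kernel of `eigenD` consists of the elements `p + i l p` with `a p = 0`, and its cokernel is
`coker a`, mapped to the target by `V ↦ V + i rV`. The claim is the splitting of the complexified
cohomology into the `∓i`-eigenspaces of `l` and `r`. -/
theorem isQuasiIso_eigenAnchor : IsQuasiIso (H.eigenD.prodMap H.eigenD) (tangentD A)
    (LinearMap.coprod LinearMap.id (conj (R := SmoothFun X)))
    (H.eigenAnchor.coprod (conj ∘ₗ H.eigenAnchor)) where
  comm := by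
    ext1 <;> ext1 <;> ext1 α <;> ext1 <;>
      simp [eigenD_apply, eigenAnchor_apply, tangentD, conj, H.a_l]
  ker_injective := by
    rintro ⟨⟨p₁, p₂⟩, ⟨q₁, q₂⟩⟩ h₁ h₂
    simp only [LinearMap.prodMap_apply, eigenD_apply, Prod.mk_eq_zero, sub_eq_zero] at h₁
    obtain ⟨⟨hp, rfl⟩, ⟨hq, rfl⟩⟩ := h₁
    simp only [LinearMap.coprod_apply, LinearMap.id_apply, conj, LinearMap.coe_mk, AddHom.coe_mk,
      Prod.mk_add_mk, Prod.mk_eq_zero] at h₂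
    obtain rfl := eq_neg_of_add_eq_zero_right h₂.1
    have h₃ : H.I₁.l p₁ = 0 := by
      have h := h₂.2
      simp only [map_neg] at h
      linear_combination (norm := module) (2⁻¹ : ℝ) • h
    have h₄ := H.Q_a p₁
    rw [hp, h₃, map_zero, map_zero, add_zero, eq_comm, neg_eq_zero] at h₄
    simp [h₄]
  ker_surjective := by
    rintro ⟨m₁, m₂⟩ h
    simp only [tangentD, LinearMap.prodMap_apply, Prod.mk_eq_zero] at h
    have h₂ := H.Q_a m₂
    rw [h.2, map_zero, zero_add] at h₂
    -- For `m = m₁ + i m₂` these are the projection `(m + i l m)/2` and the conjugate of `(m - i l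
    -- m)/2`.
    refine ⟨(((2⁻¹ : ℝ) • (m₁ - H.I₁.l m₂), (2⁻¹ : ℝ) • (m₂ + H.I₁.l m₁)),
      ((2⁻¹ : ℝ) • (m₁ + H.I₁.l m₂), (2⁻¹ : ℝ) • (H.I₁.l m₁ - m₂))), ?_, ?_⟩
    · simp only [LinearMap.prodMap_apply, eigenD_apply, LinearMap.map_smul_of_tower, map_sub,
        map_add, H.a_l, h.1, h.2, h₂]
      ext1 <;> ext1 <;> simp <;> module
    · simp only [LinearMap.coprod_apply, LinearMap.id_apply, conj, LinearMap.coe_mk,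
        AddHom.coe_mk]
      ext1 <;> simp <;> module
  coker_injective := by
    rintro ⟨⟨V, β⟩, ⟨W, η⟩⟩ ⟨⟨m₁, m₂⟩, h⟩
    simp only [LinearMap.coprod_apply, LinearMap.comp_apply, eigenAnchor_apply, conj,
      LinearMap.coe_mk, AddHom.coe_mk, tangentD, LinearMap.prodMap_apply, Prod.mk_add_mk,
      Prod.mk.injEq] at h
    obtain ⟨h₁, h₂⟩ := h
    have h₃ := congrArg H.I₁.r h₁
    rw [map_add, ← H.a_l] at h₃
    -- Applying `r` to `V + W = a m₁` and adding the second equation shows that `rV` lies in the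
    -- image of `a`; by `V = -aQV - r²V` so does `V`.
    have h₄ : H.I₁.r V = A.anchor ((2⁻¹ : ℝ) • (H.I₁.l m₁ + m₂ - β + η)) := by
      simp only [LinearMap.map_smul_of_tower, map_add, map_sub]
      linear_combination (norm := module) (2⁻¹ : ℝ) • (h₂ + h₃)
    have h₅ := H.a_Q V
    rw [h₄, ← H.a_l] at h₅
    generalize H.I₁.l ((2⁻¹ : ℝ) • (H.I₁.l m₁ + m₂ - β + η)) = c at h₅
    have h₆ : V = A.anchor (-(H.Q₁ V + c)) := by
      rw [map_neg, map_add, h₅, neg_neg]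
    generalize -(H.Q₁ V + c) = p at h₆
    subst h₆
    obtain rfl : W = A.anchor (m₁ - p) := by
      rw [map_sub]
      linear_combination (norm := module) h₁
    exact ⟨((p, β + H.I₁.l p), (m₁ - p, η + H.I₁.l (m₁ - p))), by
      simp [LinearMap.prodMap_apply, eigenD_apply]⟩
  coker_surjective := by
    rintro ⟨y₁, y₂⟩
    -- The eigenprojections of `y₁ + i y₂` would suffice if `r² = -1`; the term `-Q y₂` corrects the
    -- defect `aQ`.
    refine ⟨(((2⁻¹ : ℝ) • (y₁ - H.I₁.r y₂), 0), ((2⁻¹ : ℝ) • (y₁ + H.I₁.r y₂), 0)),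
      (0, -H.Q₁ y₂), ?_⟩
    have h := H.a_Q y₂
    simp only [LinearMap.coprod_apply, LinearMap.comp_apply, eigenAnchor_apply, conj,
      LinearMap.coe_mk, AddHom.coe_mk, tangentD, LinearMap.prodMap_apply,
      LinearMap.map_smul_of_tower, map_add, map_sub, map_zero, map_neg, add_zero]
    ext1
    · simp
      module
    · simp
      linear_combination (norm := module) h

end HomotopyHolomorphicStructure

/-! ### The foliation -/

namespace HomotopyHolomorphicStructure

variable {n : ℕ} {X : SmoothManifold.{u} n} {A : LieAlgebroid X}
  (H : HomotopyHolomorphicStructure A)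

/-- The complex Lie algebroid over `[X/A]` of a homotopy holomorphic structure: the eigenbundle
`TX ⊕ A` with the complex structure `-J`. -/
def eigenAlgebroid : ComplexLieAlgebroidOver A where
  toSmoothVectorBundle := A.tangentSum
  j := A.tangentSumEquiv.symm ∘ₗ H.eigenJ ∘ₗ A.tangentSumEquiv
  j_sq v := by
    apply A.tangentSumEquiv.injective
    simp [eigenJ_eigenJ]
  bracket := LinearMap.mk₂ ℝ (fun v w => A.tangentSumEquiv.symm
      (H.eigenBracket (A.tangentSumEquiv v) (A.tangentSumEquiv w)))
    (fun v v' w => by simp)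
    (fun c v w => by
      apply A.tangentSumEquiv.injective
      simp [A.tangentSumEquiv_const_smul])
    (fun v w w' => by simp)
    (fun c v w => by
      apply A.tangentSumEquiv.injective
      simp [A.tangentSumEquiv_const_smul])
  anchor := H.eigenAnchor ∘ₗ A.tangentSumEquiv
  bracket_self v := by simp [eigenBracket_self]
  jacobi u v w := by
    apply A.tangentSumEquiv.injective
    simpa using H.eigenBracket_jacobi _ _ _
  bracket_j v w := by
    apply A.tangentSumEquiv.injective
    simpa using H.eigenBracket_J _ _
  anchor_j v := by simpa using H.eigenAnchor_J _
  leibniz v f w := by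
    apply A.tangentSumEquiv.injective
    simpa using H.eigenBracket_leibniz _ f _
  anchor_bracket v w := by simpa using H.eigenAnchor_bracket _ _
  φ := A.tangentSumEquiv.symm ∘ₗ H.eigenφ
  anchor_φ α := by simpa using H.eigenAnchor_φ α
  φ_bracket α β := by
    apply A.tangentSumEquiv.injective
    simpa using H.eigenφ_bracket α β

/-- Sections of the eigenbundle as pairs. -/
def eigenSec : H.eigenAlgebroid.Sec ≃ₗ[SmoothFun X] VField X × A.Sec := A.tangentSumEquiv

theorem isAntiHolomorphicFoliation_eigenAlgebroid :
    H.eigenAlgebroid.IsAntiHolomorphicFoliation where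
  comm := LinearMap.ext fun p => LinearMap.congr_fun H.isQuasiIso_eigenAnchor.comm p
  ker_injective m h :=
    H.isQuasiIso_eigenAnchor.ker_injective m
      (Prod.ext (congrArg H.eigenSec (congrArg Prod.fst h))
        (congrArg H.eigenSec (congrArg Prod.snd h)))
  ker_surjective m' h := by
    obtain ⟨m, h₁, h₂⟩ := H.isQuasiIso_eigenAnchor.ker_surjective m' h
    exact ⟨m, Prod.ext (H.eigenSec.injective (congrArg Prod.fst h₁))
      (H.eigenSec.injective (congrArg Prod.snd h₁)), h₂⟩
  coker_injective y h := by
    obtain ⟨m, hm⟩ :=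
      H.isQuasiIso_eigenAnchor.coker_injective (H.eigenSec y.1, H.eigenSec y.2) h
    exact ⟨m, Prod.ext (H.eigenSec.injective (congrArg Prod.fst hm))
      (H.eigenSec.injective (congrArg Prod.snd hm))⟩
  coker_surjective y' := by
    obtain ⟨y, m', h⟩ := H.isQuasiIso_eigenAnchor.coker_surjective y'
    exact ⟨(H.eigenSec.symm y.1, H.eigenSec.symm y.2), m', h⟩

/-- The homotopy from `𝓘₁ ∘ ρ` to `ρ ∘ (-i)` on the eigenbundle. -/
def eigenHomotopy : AnchorHomotopy H.I₁ H.eigenAlgebroid where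
  γ := H.eigenγ ∘ₗ H.eigenSec
  γ_j v := H.eigenγ_J (H.eigenSec v)
  degree_zero v := H.eigenAnchor_γ (H.eigenSec v)
  degree_neg_one p := H.eigenγ_D p
  equivariant v α := H.eigenγ_bracket_φ (H.eigenSec v) α

/-! ### Explicit real formulas for the bracket -/

theorem eigenBracket_fst (p q : VField X × A.Sec) : (H.eigenBracket p q).1 =
    p.1.bracket q.1 - (H.I₁.r p.1 + A.anchor p.2).bracket (H.I₁.r q.1 + A.anchor q.2) := rfl

/-- The sign in `realPart` and the factor `-i/2` turn the second component into `-1/2` times the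
imaginary part of `preBracket`. In this form naturality under isomorphisms can be checked term by
term. -/
theorem eigenBracket_snd (p q : VField X × A.Sec) : (H.eigenBracket p q).2 = -(2⁻¹ : ℝ) •
    (A.bracket (H.eigenγ p).1 (H.eigenγ q).2 + A.bracket (H.eigenγ p).2 (H.eigenγ q).1
      + (H.I₁.D (H.eigenAnchor p).1 (H.eigenγ q).2 + H.I₁.D (H.eigenAnchor p).2 (H.eigenγ q).1)
      - (H.I₁.D (H.eigenAnchor q).1 (H.eigenγ p).2 + H.I₁.D (H.eigenAnchor q).2 (H.eigenγ p).1)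
      - (H.I₂.toLin (H.eigenAnchor p).1 (H.eigenAnchor q).2
        + H.I₂.toLin (H.eigenAnchor p).2 (H.eigenAnchor q).1)
      + H.Q₁ ((H.eigenAnchor p).1.bracket (H.eigenAnchor q).2
        + (H.eigenAnchor p).2.bracket (H.eigenAnchor q).1)) := by
  simp [eigenBracket_apply, realPart, ComplexModel.bracket, ComplexModel.preBracket, complexModel,
    eigenvector]
  module

end HomotopyHolomorphicStructure

/-- The canonical foliation of a homotopy holomorphic stack. -/
def HomotopyHolomorphicStack.foliation {n : ℕ} (𝒳 : HomotopyHolomorphicStack.{u} n) :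
    HolomorphicFoliation 𝒳 where
  L := 𝒳.hol.eigenAlgebroid
  isFoliation := 𝒳.hol.isAntiHolomorphicFoliation_eigenAlgebroid
  homotopy := 𝒳.hol.eigenHomotopy

/-! ### Functoriality -/

namespace StackIso

variable {n : ℕ} {𝒳 𝒴 : HomotopyHolomorphicStack.{u} n} (e : StackIso 𝒳 𝒴)

/-- The action of an isomorphism of stacks on sections of `TX ⊕ A`. -/
def onEigen : VField 𝒳.X × 𝒳.A.Sec ≃+ VField 𝒴.X × 𝒴.A.Sec :=
  (VField.pushEquiv e.base).prodCongr e.onA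

theorem onEigen_apply (p : VField 𝒳.X × 𝒳.A.Sec) : e.onEigen p = (p.1.push e.base, e.onA p.2) :=
  rfl

theorem push_add (V W : VField 𝒳.X) : (V + W).push e.base = V.push e.base + W.push e.base :=
  VField.push_add e.base V W

theorem push_neg (V : VField 𝒳.X) : (-V).push e.base = -V.push e.base :=
  map_neg (VField.pushEquiv e.base) V

theorem push_sub (V W : VField 𝒳.X) : (V - W).push e.base = V.push e.base - W.push e.base :=
  map_sub (VField.pushEquiv e.base) V W

/-- `onA` is only assumed additive and semilinear over functions; a real scalar is a constant
function, and push-forward preserves constants. -/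
theorem onA_const_smul (c : ℝ) (α : 𝒳.A.Sec) : e.onA (c • α) = c • e.onA α := by
  have h := e.map_smul (algebraMap ℝ (SmoothFun 𝒳.X) c) α
  rw [algebraMap_smul] at h
  rw [h]
  rfl

theorem onEigen_anchor (p : VField 𝒳.X × 𝒳.A.Sec) :
    𝒴.hol.eigenAnchor (e.onEigen p) =
      ((𝒳.hol.eigenAnchor p).1.push e.base, (𝒳.hol.eigenAnchor p).2.push e.base) := by
  simp only [HomotopyHolomorphicStructure.eigenAnchor_apply, onEigen_apply, push_add, e.map_r,
    e.map_anchor]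

theorem onEigen_γ (p : VField 𝒳.X × 𝒳.A.Sec) :
    𝒴.hol.eigenγ (e.onEigen p) = (e.onA (𝒳.hol.eigenγ p).1, e.onA (𝒳.hol.eigenγ p).2) := by
  simp only [HomotopyHolomorphicStructure.eigenγ_apply, onEigen_apply, map_add, map_neg, e.map_l,
    e.map_Q₁]

theorem onEigen_J (p : VField 𝒳.X × 𝒳.A.Sec) :
    e.onEigen (𝒳.hol.eigenJ p) = 𝒴.hol.eigenJ (e.onEigen p) := by
  simp only [HomotopyHolomorphicStructure.eigenJ_apply, onEigen_apply, map_add, map_neg, e.map_l,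
    e.map_Q₁, push_add, push_neg, e.map_r, e.map_anchor]

theorem onEigen_φ (α : 𝒳.A.Sec) : e.onEigen (𝒳.hol.eigenφ α) = 𝒴.hol.eigenφ (e.onA α) := by
  simp only [HomotopyHolomorphicStructure.eigenφ_apply, onEigen_apply, map_neg, e.map_l,
    e.map_anchor]

theorem onEigen_bracket (p q : VField 𝒳.X × 𝒳.A.Sec) :
    e.onEigen (𝒳.hol.eigenBracket p q) = 𝒴.hol.eigenBracket (e.onEigen p) (e.onEigen q) := by
  ext1
  · simp only [onEigen_apply, HomotopyHolomorphicStructure.eigenBracket_fst, push_sub, push_add,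
      VField.push_bracket, e.map_r, e.map_anchor]
  · rw [onEigen_apply, HomotopyHolomorphicStructure.eigenBracket_snd,
      HomotopyHolomorphicStructure.eigenBracket_snd]
    simp only [onEigen_anchor, onEigen_γ, onA_const_smul, map_add, map_sub, e.map_bracket,
      e.map_D, e.map_I₂, e.map_Q₁, VField.push_bracket]

/-- The lift of an isomorphism of stacks to the canonical foliations. -/
def foliationIso : FoliationIso e 𝒳.foliation 𝒴.foliation where
  onB := (𝒳.hol.eigenSec.toAddEquiv.trans e.onEigen).trans 𝒴.hol.eigenSec.symm.toAddEquiv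
  map_smul f v := 𝒴.hol.eigenSec.injective
    (Prod.ext (VField.push_smul e.base f (𝒳.hol.eigenSec v).1) (e.map_smul f (𝒳.hol.eigenSec v).2))
  map_j v := 𝒴.hol.eigenSec.injective (e.onEigen_J (𝒳.hol.eigenSec v))
  map_bracket v w :=
    𝒴.hol.eigenSec.injective (e.onEigen_bracket (𝒳.hol.eigenSec v) (𝒳.hol.eigenSec w))
  map_anchor v := (e.onEigen_anchor (𝒳.hol.eigenSec v)).symm
  map_φ α := 𝒴.hol.eigenSec.injective (e.onEigen_φ α)
  map_γ v := (e.onEigen_γ (𝒳.hol.eigenSec v)).symm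

theorem eigenSec_foliationIso (v : 𝒳.foliation.L.Sec) :
    𝒴.hol.eigenSec (e.foliationIso.onB v) = e.onEigen (𝒳.hol.eigenSec v) := rfl

end StackIso

end HomotopyHolomorphic

end

/-- Every homotopy holomorphic stack `𝒳 = ([X/A], 𝓘, 𝓠)` carries a canonical anti-holomorphic
foliation `𝓛 𝒳` together with a homotopy `γ` between `𝓘₁ ∘ ρ` and `ρ ∘ (-i)`.  Canonicity is
functoriality: every isomorphism of homotopy holomorphic stacks lifts to the foliations, compatibly
with identities and composition. -/
theorem mainTheorem4 (n : ℕ) :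
    ∃ (𝓛 : ∀ 𝒳 : HomotopyHolomorphic.HomotopyHolomorphicStack.{u} n,
        HomotopyHolomorphic.HolomorphicFoliation 𝒳)
      (lift : ∀ {𝒳 𝒴 : HomotopyHolomorphic.HomotopyHolomorphicStack.{u} n}
        (e : HomotopyHolomorphic.StackIso 𝒳 𝒴),
        HomotopyHolomorphic.FoliationIso e (𝓛 𝒳) (𝓛 𝒴)),
      (∀ (𝒳 : HomotopyHolomorphic.HomotopyHolomorphicStack.{u} n)
        (e : HomotopyHolomorphic.StackIso 𝒳 𝒳),
        (∀ x, e.base x = x) → (∀ α, e.onA α = α) → ∀ v, (lift e).onB v = v) ∧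
      (∀ (𝒳 𝒴 𝒵 : HomotopyHolomorphic.HomotopyHolomorphicStack.{u} n)
        (e : HomotopyHolomorphic.StackIso 𝒳 𝒴) (e' : HomotopyHolomorphic.StackIso 𝒴 𝒵)
        (e'' : HomotopyHolomorphic.StackIso 𝒳 𝒵),
        (∀ x, e''.base x = e'.base (e.base x)) → (∀ α, e''.onA α = e'.onA (e.onA α)) →
          ∀ v, (lift e'').onB v = (lift e').onB ((lift e).onB v)) := by
  refine ⟨fun 𝒳 => 𝒳.foliation, fun e => e.foliationIso, fun 𝒳 e hb hA v => ?_,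
    fun 𝒳 𝒴 𝒵 e e' e'' hb hA v => ?_⟩
  -- On `TX ⊕ A` the lift is push-forward of vector fields together with `onA`, so it depends only
  -- on `base` and `onA`, and both laws reduce to these components.
  · refine 𝒳.hol.eigenSec.injective ?_
    rw [HomotopyHolomorphic.StackIso.eigenSec_foliationIso]
    exact Prod.ext (HomotopyHolomorphic.VField.push_of_forall_eq _ hb _) (hA _)
  · refine 𝒵.hol.eigenSec.injective ?_
    rw [HomotopyHolomorphic.StackIso.eigenSec_foliationIso,
      HomotopyHolomorphic.StackIso.eigenSec_foliationIso,
      HomotopyHolomorphic.StackIso.eigenSec_foliationIso]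
    exact Prod.ext (HomotopyHolomorphic.VField.push_push _ _ _ hb _) (hA _)
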